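/- Let $G$ be a locally compact Hausdorff group and let $\mu$ be the smallest cardinality of a neighborhood basis at the identity $e\in G$. Let $\lambda$ be the left regular representation of $G$ on $L^2(G)$ (with respect to a left Haar measure), let $VN(G)=\lambda[G]''$ be the group von Neumann algebra, let $P_1(\widehat G)$ be the set of normal (i.e. $\sigma$-weakly continuous) states on $VN(G)$, and let $A(G)$ be the linear span of $P_1(\widehat G)$; each $u\in A(G)$ is identified with the function $u(x)=\langle \lambda(x),u\rangle$ on $G$, and $A(G)$ is an algebra under pointwise multiplication of functions. For $u\in A(G)$ and $T\in VN(G)$ let $uT\in VN(G)$ be the operator with $\langle uT,v\rangle=\langle T,uv\rangle$ for all $v\in A(G)$. A mean on $VN(G)$ is a positive linear functional $m$ with $\langle m,I\rangle=1$; it is topological invariant if $\langle m,uT\rangle=\langle m,T\rangle$ for all $u\in P_1(\widehat G)$ and $T\in VN(G)$. Let $\mathrm{TIM}(\widehat G)$ be the set of topological invariant means on $VN(G)$. If $\mu>1$, then $\mathrm{TIM}(\widehat G)$ has cardinality exactly $2^{2^{\mu}}$. -/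

import Mathlib

open MeasureTheory Topology Cardinal
open scoped ENNReal ComplexOrder

universe u

noncomputable section

/-- The smallest cardinality of a neighbourhood basis at the identity of a topological group. -/
def nbhdCharacter (G : Type u) [Group G] [TopologicalSpace G] : Cardinal.{u} :=
  sInf {c : Cardinal.{u} | ∃ B : Set (Set G), (𝓝 (1 : G)).HasBasis (fun U => U ∈ B) id ∧ #B = c}

section GroupVN

variable {G : Type u} [Group G] [TopologicalSpace G] [IsTopologicalGroup G]
  [MeasurableSpace G] [BorelSpace G] (ν : Measure G) [ν.IsHaarMeasure]

/-- The left regular representation of `G` on `L²(G)`: `(λ(x) f)(t) = f (x⁻¹ t)`. -/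
def leftRegular (x : G) : Lp ℂ 2 ν →L[ℂ] Lp ℂ 2 ν :=
  (Lp.compMeasurePreservingₗᵢ ℂ (fun t : G => x⁻¹ * t)
    (measurePreserving_mul_left ν x⁻¹)).toContinuousLinearMap

theorem leftRegular_coeFn (x : G) (f : Lp ℂ 2 ν) :
    leftRegular ν x f =ᵐ[ν] fun t => f (x⁻¹ * t) :=
  Lp.coeFn_compMeasurePreserving f (measurePreserving_mul_left ν x⁻¹)

theorem leftRegular_leftRegular (x y : G) (f : Lp ℂ 2 ν) :
    leftRegular ν x (leftRegular ν y f) = leftRegular ν (x * y) f := by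
  apply Lp.ext
  have h := (measurePreserving_mul_left ν x⁻¹).quasiMeasurePreserving.ae_eq_comp
    (leftRegular_coeFn ν y f)
  filter_upwards [leftRegular_coeFn ν x (leftRegular ν y f), leftRegular_coeFn ν (x * y) f, h]
    with t h1 h2 h3
  rw [h1, h2]
  simpa [mul_assoc] using h3

theorem leftRegular_one : leftRegular ν (1 : G) = 1 := by
  ext1 f
  apply Lp.ext
  filter_upwards [leftRegular_coeFn ν 1 f] with t h
  simp [h]

theorem leftRegular_star (x : G) : star (leftRegular ν x) = leftRegular ν x⁻¹ := by
  rw [ContinuousLinearMap.star_eq_adjoint]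
  symm
  rw [ContinuousLinearMap.eq_adjoint_iff]
  intro f g
  have h : inner ℂ (leftRegular ν x (leftRegular ν x⁻¹ f)) (leftRegular ν x g)
      = inner ℂ (leftRegular ν x⁻¹ f) g :=
    LinearIsometry.inner_map_map (𝕜 := ℂ) (Lp.compMeasurePreservingₗᵢ ℂ (fun t : G => x⁻¹ * t)
      (measurePreserving_mul_left ν x⁻¹)) (leftRegular ν x⁻¹ f) g
  rw [← h, leftRegular_leftRegular, mul_inv_cancel, leftRegular_one]
  rfl

/-- The group von Neumann algebra `VN(G) = λ[G]''`, acting on `L²(G)`. (The commutant of a set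
`s` as a star subalgebra is the centralizer of `s ∪ star s`; see `coe_groupVN`.) -/
def groupVN : VonNeumannAlgebra (Lp ℂ 2 ν) where
  toStarSubalgebra := StarSubalgebra.centralizer ℂ
    (StarSubalgebra.centralizer ℂ (Set.range (leftRegular ν)) : Set (Lp ℂ 2 ν →L[ℂ] Lp ℂ 2 ν))
  centralizer_centralizer' := by simp

theorem coe_groupVN : (groupVN ν : Set (Lp ℂ 2 ν →L[ℂ] Lp ℂ 2 ν)) =
    Set.centralizer (Set.centralizer (Set.range (leftRegular ν))) := by
  have hs : star (Set.range (leftRegular ν)) ⊆ Set.range (leftRegular ν) := by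
    rintro T ⟨x, hx⟩
    exact ⟨x⁻¹, by rw [← leftRegular_star, hx, star_star]⟩
  change ((StarSubalgebra.centralizer ℂ
    (StarSubalgebra.centralizer ℂ (Set.range (leftRegular ν)) :
      Set (Lp ℂ 2 ν →L[ℂ] Lp ℂ 2 ν)) : StarSubalgebra ℂ (Lp ℂ 2 ν →L[ℂ] Lp ℂ 2 ν)) :
      Set (Lp ℂ 2 ν →L[ℂ] Lp ℂ 2 ν)) = _
  have hs' : star (Set.range (leftRegular ν)) = Set.range (leftRegular ν) :=
    Set.Subset.antisymm hs (by simpa using Set.star_subset_star.mpr hs)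
  simp [StarSubalgebra.coe_centralizer, Set.star_centralizer, hs']

/-- The elements of `VN(G)`, as a normed star algebra. -/
abbrev VN : StarSubalgebra ℂ (Lp ℂ 2 ν →L[ℂ] Lp ℂ 2 ν) := (groupVN ν).toStarSubalgebra

/-- `λ(x)` as an element of `VN(G)`. -/
def lam (x : G) : VN ν :=
  ⟨leftRegular ν x, by
    have h : leftRegular ν x ∈ (groupVN ν : Set (Lp ℂ 2 ν →L[ℂ] Lp ℂ 2 ν)) := by
      rw [coe_groupVN]
      exact Set.subset_centralizer_centralizer ⟨x, rfl⟩
    exact h⟩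

/-- A mean (state) on `VN(G)`: a positive unital functional. -/
def IsMean (m : StrongDual ℂ (VN ν)) : Prop :=
  m 1 = 1 ∧ ∀ T : VN ν, (T : Lp ℂ 2 ν →L[ℂ] Lp ℂ 2 ν).IsPositive → 0 ≤ m T

/-- A functional on `VN(G)` is normal if it is `σ`-weakly continuous, i.e. of the form
`T ↦ ∑ₙ ⟨T fₙ, gₙ⟩` with `∑ₙ ‖fₙ‖² < ∞` and `∑ₙ ‖gₙ‖² < ∞`.
(Mathlib's inner product is conjugate linear in its first argument.) -/
def IsNormalFunctional (φ : StrongDual ℂ (VN ν)) : Prop :=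
  ∃ f g : ℕ → Lp ℂ 2 ν, Summable (fun n => ‖f n‖ ^ 2) ∧ Summable (fun n => ‖g n‖ ^ 2) ∧
    ∀ T : VN ν, HasSum
      (fun n => inner ℂ (g n) ((T : Lp ℂ 2 ν →L[ℂ] Lp ℂ 2 ν) (f n))) (φ T)

/-- The normal states on `VN(G)`. -/
def normalStates : Set (StrongDual ℂ (VN ν)) :=
  {φ | IsMean ν φ ∧ IsNormalFunctional ν φ}

/-- The Fourier algebra `A(G)`: the linear span of the normal states on `VN(G)`. An element `φ`
corresponds to the function `x ↦ φ (λ(x))` on `G`. -/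
def fourierAlgebra : Submodule ℂ (StrongDual ℂ (VN ν)) :=
  Submodule.span ℂ (normalStates ν)

/-- `w = u v` in the Fourier algebra, whose product is the pointwise product of functions. -/
def IsFourierMul (u v w : StrongDual ℂ (VN ν)) : Prop :=
  ∀ x : G, w (lam ν x) = u (lam ν x) * v (lam ν x)

/-- `S = u T`, where `u T` is the element of `VN(G)` with `⟨u T, v⟩ = ⟨T, u v⟩` for all
`v ∈ A(G)`. That the product `u v` lies in `A(G)` is part of the assertion. -/
def IsFourierSMul (u : StrongDual ℂ (VN ν)) (T S : VN ν) : Prop :=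
  ∀ v ∈ fourierAlgebra ν, ∃ w ∈ fourierAlgebra ν, IsFourierMul ν u v w ∧ v S = w T

/-- The topological invariant means on `VN(G)`: the means `m` with `⟨m, u T⟩ = ⟨m, T⟩` for all
normal states `u` and all `T ∈ VN(G)`. That `u T` exists is part of the assertion. -/
def TIM : Set (StrongDual ℂ (VN ν)) :=
  {m | IsMean ν m ∧ ∀ u ∈ normalStates ν, ∀ T : VN ν, ∃ S : VN ν,
    IsFourierSMul ν u T S ∧ m S = m T}

end GroupVN

end

/-! Write `μ` for `nbhdCharacter G`; since it exceeds 1, it is infinite (`aleph0_le_nbhdCharacter`).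
Both bounds rest on a concrete model of the action of `A(G)` on `VN(G)`. Twisting `f ⊗ h` into `s ↦
f(s) λ(s⁻¹)h` turns `λ(x) ⊗ 1` into the diagonal action `λ(x) ⊗ λ(x)` (Fell absorption). Hence
compressing an amplification of `T` by twisted vectors gives `u T` (`slice`, `act`). Identities
between normal functionals need checking only on the operators `λ(x)`, by von Neumann's density
argument (`IsNormalFunctional.ext`).

Upper bound (`mk_TIM_le`): fix a unit vector `f` supported in a compact neighbourhood `K` of the
identity, and its vector state `u`. An invariant mean satisfies `m(T) = m(u T)`, and `u T` depends
only on the compression of `T` to `L²(K)`. That compression is determined by at most `μ` matrix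
entries, because the topology near `K` is controlled by `μ` open sets. So `m` factors through a set
of size at most `2^μ`, which leaves at most `2^(2^μ)` means.

Lower bound (`le_mk_TIM`): vector states of unit vectors whose supports shrink to the identity are
asymptotically invariant, because there the twisted vector is close to the untwisted tensor. Their
limits along ultrafilters are therefore invariant means (`exists_mem_TIM_of_ultrafilter`). An
independent family of sets yields `2^(2^μ)` ultrafilters on a set of size `μ` along which prescribed
neighbourhoods shrink. To keep the limits distinct, the vectors `f_γ` come with positive `E_γ` in
`VN(G)` whose finite sums are at most 1 and with `⟨E_γ f_γ, f_γ⟩ ≥ 3/4`. A weak limit of partial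
sums over a set of indices then separates that set from its complement.

The operators `E_γ` are differences along an increasing chain in `VN(G)`. For uncountable `μ` the
chain consists of projections onto the vectors fixed by a decreasing transfinite family of
subgroups, each an intersection of fewer than `μ` closed `G_δ` subgroups until the end and hence
infinite. For `μ = ℵ₀` it consists of spectral truncations `min(n a, 1)` of a positive injective `a`
in `VN(G)` that is small on vectors concentrated near the identity. -/

noncomputable section

set_option maxHeartbeats 1000000
set_option linter.unusedSectionVars false

/-! ### Amplifications of operators and von Neumann's density argument -/

section Amplification

variable {H : Type*} [NormedAddCommGroup H] {ι : Type*}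

local notation "𝓗[" ι "," H "]" => lp (fun _ : ι => H) 2

theorem memℓp_two_iff_summable {f : ι → H} : Memℓp f 2 ↔ Summable fun i => ‖f i‖ ^ 2 := by
  rw [memℓp_gen_iff (by norm_num)]
  simp

theorem lp_two_norm_sq (f : 𝓗[ι, H]) : ‖f‖ ^ 2 = ∑' i, ‖f i‖ ^ 2 := by
  have := lp.norm_rpow_eq_tsum (p := 2) (by norm_num) f
  simpa using this

theorem lp_two_summable (f : 𝓗[ι, H]) : Summable fun i => ‖f i‖ ^ 2 :=
  memℓp_two_iff_summable.1 (lp.memℓp f)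

/-- A square-summable family, as an element of the Hilbert sum. -/
def toHilbertSum (f : ι → H) (hf : Summable fun i => ‖f i‖ ^ 2) : 𝓗[ι, H] :=
  ⟨f, memℓp_two_iff_summable.2 hf⟩

theorem toHilbertSum_apply (f : ι → H) (hf : Summable fun i => ‖f i‖ ^ 2) (i : ι) :
    toHilbertSum f hf i = f i := rfl

variable [InnerProductSpace ℂ H]

/-- A bounded operator acting coordinatewise on a Hilbert sum of copies of a Hilbert space. -/
def amp (ι : Type*) (T : H →L[ℂ] H) : 𝓗[ι, H] →L[ℂ] 𝓗[ι, H] :=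
  LinearMap.mkContinuous
    { toFun := fun f => ⟨fun i => T (f i), memℓp_two_iff_summable.2 <|
        Summable.of_nonneg_of_le (fun _ => by positivity)
          (fun i => by
            have := T.le_opNorm (f i)
            calc ‖T (f i)‖ ^ 2 ≤ (‖T‖ * ‖f i‖) ^ 2 := by gcongr
              _ = ‖T‖ ^ 2 * ‖f i‖ ^ 2 := by ring)
          ((lp_two_summable f).mul_left (‖T‖ ^ 2))⟩
      map_add' := fun f g => by ext i; exact map_add T _ _
      map_smul' := fun c f => by ext i; simp }
    ‖T‖ (fun f => by
      refine lp.norm_le_of_forall_sum_le (by norm_num) (by positivity) fun s => ?_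
      simp only [LinearMap.coe_mk, AddHom.coe_mk, ENNReal.toReal_ofNat, Real.rpow_ofNat]
      calc ∑ i ∈ s, ‖T (f i)‖ ^ 2 ≤ ∑ i ∈ s, ‖T‖ ^ 2 * ‖f i‖ ^ 2 := by
            gcongr with i
            rw [← mul_pow]
            gcongr
            exact T.le_opNorm _
        _ = ‖T‖ ^ 2 * ∑ i ∈ s, ‖f i‖ ^ 2 := by rw [Finset.mul_sum]
        _ ≤ ‖T‖ ^ 2 * ‖f‖ ^ 2 := by
            gcongr
            rw [lp_two_norm_sq]
            exact (lp_two_summable f).sum_le_tsum _ fun _ _ => by positivity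
        _ = _ := by rw [mul_pow])

@[simp]
theorem amp_apply (T : H →L[ℂ] H) (f : 𝓗[ι, H]) (i : ι) : amp ι T f i = T (f i) := rfl

theorem norm_amp_apply_le (T : H →L[ℂ] H) (f : 𝓗[ι, H]) : ‖amp ι T f‖ ≤ ‖T‖ * ‖f‖ :=
  (amp ι T).le_of_opNorm_le (LinearMap.mkContinuous_norm_le _ (norm_nonneg T) _) f

theorem amp_add (S T : H →L[ℂ] H) : amp ι (S + T) = amp ι S + amp ι T := by
  ext f i; simp

theorem amp_smul (c : ℂ) (T : H →L[ℂ] H) : amp ι (c • T) = c • amp ι T := by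
  ext f i; simp

theorem amp_mul (S T : H →L[ℂ] H) : amp ι (S * T) = amp ι S * amp ι T := by
  ext f i; simp

theorem amp_one : amp ι (1 : H →L[ℂ] H) = 1 := by
  ext f i; simp

theorem inner_amp_left [CompleteSpace H] (T : H →L[ℂ] H) (f g : 𝓗[ι, H]) :
    inner ℂ (amp ι (star T) f) g = inner ℂ f (amp ι T g) := by
  rw [lp.inner_eq_tsum, lp.inner_eq_tsum]
  congr 1 with i
  rw [amp_apply, amp_apply, ContinuousLinearMap.star_eq_adjoint,
    ContinuousLinearMap.adjoint_inner_left]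

/-- Continuous linear maps on a Hilbert sum that agree on single coordinates are equal. -/
theorem lp_clm_ext [DecidableEq ι] {E : Type*} [NormedAddCommGroup E]
    [NormedSpace ℂ E] {A B : 𝓗[ι, H] →L[ℂ] E}
    (h : ∀ i v, A (lp.single 2 i v) = B (lp.single 2 i v)) : A = B := by
  ext f
  have hf := lp.hasSum_single (p := 2) (by norm_num) f
  have h1 := A.hasSum hf
  have h2 := B.hasSum hf
  simp only [h] at h1
  exact h1.unique h2

theorem star_amp [CompleteSpace H] (T : H →L[ℂ] H) : star (amp ι T) = amp ι (star T) := by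
  rw [ContinuousLinearMap.star_eq_adjoint]
  symm
  rw [ContinuousLinearMap.eq_adjoint_iff]
  exact fun f g => inner_amp_left T f g

/-- The orthogonal projection onto a closed subspace invariant under an operator and its adjoint
commutes with that operator. -/
theorem starProjection_commute_of_invariant [CompleteSpace H] (M : Submodule ℂ H)
    [M.HasOrthogonalProjection] {A : H →L[ℂ] H} (hA : ∀ v ∈ M, A v ∈ M)
    (hA' : ∀ v ∈ M, star A v ∈ M) (w : H) :
    M.starProjection (A w) = A (M.starProjection w) := by
  refine Submodule.eq_starProjection_of_mem_orthogonal (hA _ (M.starProjection_apply_mem w)) ?_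
  rw [← map_sub, Submodule.mem_orthogonal']
  intro v hv
  rw [← ContinuousLinearMap.adjoint_inner_right, ← ContinuousLinearMap.star_eq_adjoint]
  exact Submodule.inner_left_of_mem_orthogonal (hA' v hv)
    (M.sub_starProjection_mem_orthogonal w)

variable [CompleteSpace H] {G : Type*} [Group G]

/-- Von Neumann's density argument: a vector functional on an amplification that vanishes on a
unitary group of operators vanishes on its bicommutant. -/
theorem inner_amp_eq_zero_of_mem_bicommutant (π : G → H →L[ℂ] H)
    (hmul : ∀ x y, π (x * y) = π x * π y) (hone : π 1 = 1) (hstar : ∀ x, star (π x) = π x⁻¹)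
    {T : H →L[ℂ] H} (hT : T ∈ Set.centralizer (Set.centralizer (Set.range π)))
    (F K : 𝓗[ι, H]) (h0 : ∀ x, inner ℂ K (amp ι (π x) F) = 0) :
    inner ℂ K (amp ι T F) = 0 := by
  classical
  let M : Submodule ℂ 𝓗[ι, H] :=
    (Submodule.span ℂ (Set.range fun x => amp ι (π x) F)).topologicalClosure
  have : CompleteSpace M := (Submodule.isClosed_topologicalClosure _).completeSpace_coe
  have hKM : K ∈ Mᗮ := by
    rw [Submodule.orthogonal_closure, Submodule.mem_orthogonal']
    intro w hw
    induction hw using Submodule.span_induction with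
    | mem w hw => obtain ⟨x, rfl⟩ := hw; exact h0 x
    | zero => simp
    | add a b _ _ ha hb => rw [inner_add_right, ha, hb, add_zero]
    | smul c a _ ha => rw [inner_smul_right, ha, mul_zero]
  have hFM : F ∈ M := by
    apply Submodule.le_topologicalClosure
    apply Submodule.subset_span
    exact ⟨1, by simp [hone, amp_one]⟩
  have hinv : ∀ x, ∀ w ∈ M, amp ι (π x) w ∈ M := by
    intro x w hw
    have : M ≤ M.comap (amp ι (π x)).toLinearMap := by
      refine Submodule.topologicalClosure_minimal _ ?_ ?_
      · rw [Submodule.span_le]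
        rintro _ ⟨y, rfl⟩
        apply Submodule.le_topologicalClosure
        apply Submodule.subset_span
        exact ⟨x * y, by simp [hmul, amp_mul]⟩
      · exact (Submodule.isClosed_topologicalClosure _).preimage (amp ι (π x)).continuous
    exact this hw
  let P := M.starProjection
  have hcomm : ∀ x w, P (amp ι (π x) w) = amp ι (π x) (P w) := by
    intro x w
    exact starProjection_commute_of_invariant M (hinv x)
      (fun v hv => by rw [star_amp, hstar]; exact hinv _ v hv) w
  have hcommT : ∀ w, P (amp ι T w) = amp ι T (P w) := by
    intro w
    have : P * amp ι T = amp ι T * P := by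
      refine lp_clm_ext fun j v => ?_
      ext i
      -- The matrix blocks of `P` commute with every `π x`, so `T` commutes with each block; this
      -- gives commutation of `P` with the amplification of `T`.
      let Pij : H →L[ℂ] H := (lp.evalCLM ℂ (fun _ : ι => H) 2 i) ∘L P ∘L
        (lp.singleContinuousLinearMap ℂ (fun _ : ι => H) 2 j)
      have hamp : ∀ (S : H →L[ℂ] H) (u : H), amp ι S (lp.single 2 j u) = lp.single 2 j (S u) := by
        intro S u
        ext k
        by_cases hk : k = j
        · subst hk; simp
        · simp [hk]
      have hPij : Pij ∈ Set.centralizer (Set.range π) := by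
        rw [Set.mem_centralizer_iff]
        rintro _ ⟨x, rfl⟩
        ext u
        have := congrArg (fun z : 𝓗[ι, H] => z i) (hcomm x (lp.single 2 j u))
        simp only [hamp, amp_apply] at this
        exact this.symm
      have h2 := (Set.mem_centralizer_iff.1 hT) Pij hPij
      have h3 := congrArg (fun A : H →L[ℂ] H => A v) h2
      simp only [mul_apply_eq_comp, hamp, amp_apply]
      exact h3
    exact congrArg (fun A : 𝓗[ι, H] →L[ℂ] 𝓗[ι, H] => A w) this
  have hPF : P F = F := Submodule.starProjection_eq_self_iff.2 hFM
  have : amp ι T F ∈ M := by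
    rw [← hPF, ← hcommT]
    exact M.starProjection_apply_mem _
  exact Submodule.inner_left_of_mem_orthogonal this hKM

end Amplification

/-! ### Tensor decomposition of `L²(X; E)` -/

section VectorValued

variable {X : Type*} [MeasurableSpace X] (ν : Measure X)
  {E : Type*} [NormedAddCommGroup E] [InnerProductSpace ℂ E]

/-- The elementary tensor `f ⊗ v` in `L²(X; E)`, that is, the function `s ↦ f(s) v`. -/
def tens : E →L[ℂ] Lp ℂ 2 ν →L[ℂ] Lp E 2 ν :=
  (ContinuousLinearMap.lsmul ℂ ℂ : ℂ →L[ℂ] E →L[ℂ] E).flip.compLpL₂ 2 ν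

theorem coeFn_tens (v : E) (f : Lp ℂ 2 ν) : tens ν v f =ᵐ[ν] fun s => f s • v :=
  ContinuousLinearMap.coeFn_compLp' _ f

theorem inner_tens_tens (v w : E) (f g : Lp ℂ 2 ν) :
    inner ℂ (tens ν v f) (tens ν w g) = inner ℂ f g * inner ℂ v w := by
  rw [L2.inner_def, L2.inner_def, ← integral_mul_const]
  apply integral_congr_ae
  filter_upwards [coeFn_tens ν v f, coeFn_tens ν w g] with s h1 h2
  rw [h1, h2, inner_smul_left, inner_smul_right, RCLike.inner_apply]
  ring

theorem inner_tens_eq_integral (v : E) (f : Lp ℂ 2 ν) (F : Lp E 2 ν) :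
    inner ℂ (tens ν v f) F = ∫ s, (starRingEnd ℂ) (f s) * inner ℂ v (F s) ∂ν := by
  rw [L2.inner_def]
  apply integral_congr_ae
  filter_upwards [coeFn_tens ν v f] with s h1
  rw [h1, inner_smul_left]

theorem norm_tens (v : E) (f : Lp ℂ 2 ν) : ‖tens ν v f‖ = ‖f‖ * ‖v‖ := by
  have h := inner_tens_tens ν v v f f
  simp only [inner_self_eq_norm_sq_to_K] at h
  have h2 : ‖tens ν v f‖ ^ 2 = (‖f‖ * ‖v‖) ^ 2 := by
    rw [mul_pow]
    exact_mod_cast h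
  exact (pow_left_inj₀ (norm_nonneg _) (by positivity) two_ne_zero).1 h2

theorem tens_indicatorConstLp (v : E) {s : Set X} (hs : MeasurableSet s) (hνs : ν s ≠ ∞) :
    tens ν v (indicatorConstLp 2 hs hνs (1 : ℂ)) = indicatorConstLp 2 hs hνs v := by
  apply Lp.ext
  filter_upwards [coeFn_tens ν v (indicatorConstLp 2 hs hνs (1 : ℂ)),
    indicatorConstLp_coeFn (p := 2) (hs := hs) (hμs := hνs) (c := (1 : ℂ)),
    indicatorConstLp_coeFn (p := 2) (hs := hs) (hμs := hνs) (c := v)] with t h1 h2 h3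
  rw [h1, h2, h3]
  by_cases ht : t ∈ s <;> simp [ht]

/-- Elementary tensors span a dense subspace of `L²(X; E)`. -/
theorem mem_of_tens_mem (M : Submodule ℂ (Lp E 2 ν)) (hM : IsClosed (M : Set (Lp E 2 ν)))
    (h : ∀ v f, tens ν v f ∈ M) (F : Lp E 2 ν) : F ∈ M := by
  refine Lp.induction (p := 2) (by norm_num) (fun F => F ∈ M) ?_ ?_ hM F
  · intro c s hs hνs
    rw [Lp.simpleFunc.coe_indicatorConst, ← tens_indicatorConstLp]
    exact h _ _
  · intro f g _ _ _ h1 h2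
    exact M.add_mem h1 h2

variable {I : Type*} [CompleteSpace E] (b : HilbertBasis I ℂ E)

omit [CompleteSpace E] in
/-- The isometric embedding `f ↦ f ⊗ bᵢ`, for `b` a Hilbert basis. -/
def tensIsometry (i : I) : Lp ℂ 2 ν →ₗᵢ[ℂ] Lp E 2 ν where
  toLinearMap := (tens ν (b i)).toLinearMap
  norm_map' f := by
    simpa [b.orthonormal.norm_eq_one] using norm_tens ν (b i) f

omit [CompleteSpace E] in
theorem tensIsometry_apply (i : I) (f : Lp ℂ 2 ν) : tensIsometry ν b i f = tens ν (b i) f := rfl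

theorem isHilbertSum_tensIsometry :
    IsHilbertSum ℂ (fun _ : I => Lp ℂ 2 ν) (tensIsometry ν b) := by
  refine IsHilbertSum.mk ?_ ?_
  · intro i j hij f g
    rw [tensIsometry_apply, tensIsometry_apply, inner_tens_tens, b.orthonormal.inner_eq_zero hij,
      mul_zero]
  · intro F _
    refine mem_of_tens_mem ν _ (Submodule.isClosed_topologicalClosure _) (fun v f => ?_) F
    have hv := b.hasSum_repr v
    have h1 : HasSum (fun i => b.repr v i • tens ν (b i) f) (tens ν v f) := by
      have := ((ContinuousLinearMap.apply ℂ (Lp E 2 ν) f).comp (tens ν)).hasSum hv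
      simpa using this
    refine (Submodule.isClosed_topologicalClosure _).mem_of_tendsto h1 (.of_forall fun s => ?_)
    refine Submodule.sum_mem _ fun i _ => Submodule.smul_mem _ _ ?_
    apply Submodule.le_topologicalClosure
    exact Submodule.mem_iSup_of_mem i ⟨f, rfl⟩

/-- `L²(X; E)` as the Hilbert sum of copies of `L²(X)` indexed by a Hilbert basis of `E`. -/
def coords : Lp E 2 ν ≃ₗᵢ[ℂ] lp (fun _ : I => Lp ℂ 2 ν) 2 :=
  (isHilbertSum_tensIsometry ν b).linearIsometryEquiv

/-- The coordinates come from an abstract Hilbert sum isomorphism; this weak pairing is the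
description used in computations. -/
theorem inner_coords (F : Lp E 2 ν) (i : I) (g : Lp ℂ 2 ν) :
    inner ℂ g (coords ν b F i) = inner ℂ (tens ν (b i) g) F := by
  classical
  rw [← lp.inner_single_left (𝕜 := ℂ) i g (coords ν b F), ← tensIsometry_apply,
    ← IsHilbertSum.linearIsometryEquiv_symm_apply_single (isHilbertSum_tensIsometry ν b)]
  change _ = inner ℂ ((coords ν b).symm (lp.single 2 i g)) F
  rw [← LinearIsometryEquiv.inner_map_map (coords ν b) ((coords ν b).symm (lp.single 2 i g)) F,
    LinearIsometryEquiv.apply_symm_apply]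

theorem coords_tens (v : E) (f : Lp ℂ 2 ν) (i : I) :
    coords ν b (tens ν v f) i = inner ℂ (b i) v • f := by
  refine ext_inner_left ℂ fun g => ?_
  rw [inner_coords, inner_tens_tens, inner_smul_right, mul_comm]

end VectorValued

/-! ### Twisted tensors and Fell absorption -/

section Twist

/-- Neither `X` nor `E` is assumed second countable. By inner regularity `s` is a countable union of
compact sets up to a null set, and `c` is strongly measurable on each of them. -/
theorem Continuous.aestronglyMeasurable_restrict_of_finite_measure {X : Type*} [TopologicalSpace X]
    [R1Space X] [MeasurableSpace X] [BorelSpace X] {ν : Measure X} [ν.Regular]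
    {E : Type*} [NormedAddCommGroup E] {c : X → E} (hc : Continuous c) {s : Set X}
    (hs : MeasurableSet s) (hνs : ν s ≠ ∞) : AEStronglyMeasurable c (ν.restrict s) := by
  have h (n : ℕ) := hs.exists_isCompact_isClosed_sdiff_lt hνs (ε := ((n : ℝ≥0∞) + 1)⁻¹) (by simp)
  choose K hKs hKc hKcl hKn using h
  have hae : (⋃ n, K n : Set X) =ᵐ[ν] s := by
    refine (Set.iUnion_subset hKs).eventuallyLE.antisymm ?_
    rw [ae_le_set]
    refine le_antisymm (ENNReal.le_of_forall_pos_le_add fun ε hε _ => ?_) zero_le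
    obtain ⟨n, hn⟩ := ENNReal.exists_inv_nat_lt (a := (ε : ℝ≥0∞)) (by simpa using hε.ne')
    rw [zero_add]
    calc ν (s \ ⋃ n, K n) ≤ ν (s \ K n) :=
          measure_mono (Set.sdiff_subset_sdiff_right (Set.subset_iUnion K n))
      _ ≤ ((n : ℝ≥0∞) + 1)⁻¹ := (hKn n).le
      _ ≤ (n : ℝ≥0∞)⁻¹ := ENNReal.inv_le_inv.2 le_self_add
      _ ≤ ε := hn.le
  rw [← Measure.restrict_congr_set hae, aestronglyMeasurable_iUnion_iff]
  exact fun n => hc.continuousOn.aestronglyMeasurable_of_isCompact (hKc n) (hKcl n).measurableSet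

/-- An `L²` function is an almost everywhere limit of simple functions with supports of finite
measure, which reduces the claim to such sets. -/
theorem aestronglyMeasurable_smul_of_continuous {X : Type*} [TopologicalSpace X] [R1Space X]
    [MeasurableSpace X] [BorelSpace X] {ν : Measure X} [ν.Regular]
    {E : Type*} [NormedAddCommGroup E] [NormedSpace ℂ E] {f : X → ℂ} (hf : MemLp f 2 ν)
    {c : X → E} (hc : Continuous c) : AEStronglyMeasurable (fun s => f s • c s) ν := by
  obtain ⟨g, ⟨fs, hfin, hlim⟩, hfg⟩ := hf.aefinStronglyMeasurable (by norm_num) (by norm_num)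
  refine aestronglyMeasurable_of_tendsto_ae Filter.atTop (f := fun n s => fs n s • c s)
    (fun n => ?_) ?_
  · have hm : MeasurableSet (Function.support (fs n)) := (fs n).measurableSet_support
    have : (fun s => fs n s • c s) =
        (Function.support (fs n)).indicator (fun s => fs n s • c s) := by
      symm
      rw [Set.indicator_eq_self]
      exact Function.support_smul_subset_left _ _
    rw [this, aestronglyMeasurable_indicator_iff hm]
    exact (fs n).aestronglyMeasurable.smul
      (hc.aestronglyMeasurable_restrict_of_finite_measure hm (hfin n).ne)
  · filter_upwards [hfg] with s hs
    rw [hs]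
    exact (hlim s).smul_const _

variable {G : Type u} [Group G] [TopologicalSpace G] [IsTopologicalGroup G]
  [MeasurableSpace G] [BorelSpace G] (ν : Measure G) [ν.IsHaarMeasure]

theorem norm_leftRegular (x : G) (f : Lp ℂ 2 ν) : ‖leftRegular ν x f‖ = ‖f‖ :=
  LinearIsometry.norm_map (Lp.compMeasurePreservingₗᵢ ℂ (fun t : G => x⁻¹ * t)
    (measurePreserving_mul_left ν x⁻¹)) f

theorem inner_leftRegular_leftRegular (x : G) (f g : Lp ℂ 2 ν) :
    inner ℂ (leftRegular ν x f) (leftRegular ν x g) = inner ℂ f g :=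
  LinearIsometry.inner_map_map (𝕜 := ℂ) (Lp.compMeasurePreservingₗᵢ ℂ (fun t : G => x⁻¹ * t)
    (measurePreserving_mul_left ν x⁻¹)) f g

variable [LocallyCompactSpace G] [ν.Regular]

theorem continuous_leftRegular (f : Lp ℂ 2 ν) : Continuous fun x => leftRegular ν x f := by
  have h : Continuous fun x : G =>
      (⟨fun t : G => x⁻¹ * t, by fun_prop⟩ : C(G, G)) :=
    ContinuousMap.continuous_of_continuous_uncurry _ (by
      change Continuous fun p : G × G => p.1⁻¹ * p.2
      fun_prop)
  exact Continuous.compMeasurePreservingLp (f := fun _ : G => f) continuous_const h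
    (fun x => measurePreserving_mul_left ν x⁻¹) (by norm_num)

theorem memLp_twist (f h : Lp ℂ 2 ν) :
    MemLp (fun s => f s • leftRegular ν s⁻¹ h) 2 ν := by
  refine MemLp.of_le_mul (g := f) (c := ‖h‖) (Lp.memLp f) ?_ (.of_forall fun s => ?_)
  · exact aestronglyMeasurable_smul_of_continuous (Lp.memLp f)
      ((continuous_leftRegular ν h).comp continuous_inv)
  · rw [norm_smul, norm_leftRegular, mul_comm]

/-- The function `s ↦ f(s) λ(s⁻¹)h` in `L²(G; L²(G))`. -/
def twist (f h : Lp ℂ 2 ν) : Lp (Lp ℂ 2 ν) 2 ν := (memLp_twist ν f h).toLp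

theorem coeFn_twist (f h : Lp ℂ 2 ν) :
    twist ν f h =ᵐ[ν] fun s => f s • leftRegular ν s⁻¹ h := (memLp_twist ν f h).coeFn_toLp

theorem inner_twist_twist (f g h k : Lp ℂ 2 ν) :
    inner ℂ (twist ν g k) (twist ν f h) = inner ℂ g f * inner ℂ k h := by
  rw [L2.inner_def, L2.inner_def, ← integral_mul_const]
  apply integral_congr_ae
  filter_upwards [coeFn_twist ν f h, coeFn_twist ν g k] with s h1 h2
  rw [h1, h2, inner_smul_left, inner_smul_right, inner_leftRegular_leftRegular,
    RCLike.inner_apply]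
  ring

theorem norm_twist (f h : Lp ℂ 2 ν) : ‖twist ν f h‖ = ‖f‖ * ‖h‖ := by
  have h := inner_twist_twist ν f f h h
  simp only [inner_self_eq_norm_sq_to_K] at h
  have h2 : ‖twist ν f ‹Lp ℂ 2 ν›‖ ^ 2 = (‖f‖ * ‖‹Lp ℂ 2 ν›‖) ^ 2 := by
    rw [mul_pow]
    exact_mod_cast h
  exact (pow_left_inj₀ (norm_nonneg _) (by positivity) two_ne_zero).1 h2

theorem twist_add_right (f h k : Lp ℂ 2 ν) : twist ν f (h + k) = twist ν f h + twist ν f k := by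
  apply Lp.ext
  filter_upwards [coeFn_twist ν f (h + k), coeFn_twist ν f h, coeFn_twist ν f k,
    Lp.coeFn_add (twist ν f h) (twist ν f k)] with s h1 h2 h3 h4
  rw [h1, h4, Pi.add_apply, h2, h3, map_add, smul_add]

theorem twist_smul_right (c : ℂ) (f h : Lp ℂ 2 ν) : twist ν f (c • h) = c • twist ν f h := by
  apply Lp.ext
  filter_upwards [coeFn_twist ν f (c • h), coeFn_twist ν f h,
    Lp.coeFn_smul c (twist ν f h)] with s h1 h2 h3
  rw [h1, h3, Pi.smul_apply, h2, map_smul, smul_comm]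

/-- The translation `F ↦ F(x⁻¹ ·)` intertwines with the diagonal action of the regular
representation in coordinates. -/
theorem amp_coords_twist {I : Type*} (b : HilbertBasis I ℂ (Lp ℂ 2 ν)) (x : G)
    (f h : Lp ℂ 2 ν) :
    amp I (leftRegular ν x) (coords ν b (twist ν f h)) =
      coords ν b (twist ν (leftRegular ν x f) (leftRegular ν x h)) := by
  ext1
  funext i
  refine ext_inner_left ℂ fun g => ?_
  have hx := leftRegular_coeFn ν x⁻¹ g
  have hstar : inner ℂ g (leftRegular ν x (coords ν b (twist ν f h) i)) =
      inner ℂ (leftRegular ν x⁻¹ g) (coords ν b (twist ν f h) i) := by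
    rw [← leftRegular_star, ContinuousLinearMap.star_eq_adjoint,
      ContinuousLinearMap.adjoint_inner_left]
  rw [amp_apply, inner_coords, hstar, inner_coords, inner_tens_eq_integral,
    inner_tens_eq_integral]
  rw [← integral_mul_left_eq_self (μ := ν) (fun s => (starRingEnd ℂ) (g s) *
    inner ℂ (b i) (twist ν (leftRegular ν x f) (leftRegular ν x h) s)) x]
  apply integral_congr_ae
  have hq := (measurePreserving_mul_left ν x).quasiMeasurePreserving
  filter_upwards [hx, coeFn_twist ν f h,
    hq.ae_eq_comp (coeFn_twist ν (leftRegular ν x f) (leftRegular ν x h)),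
    hq.ae_eq_comp (leftRegular_coeFn ν x f)] with s h1 h2 h3 h4
  simp only [Function.comp_apply] at h3 h4
  rw [h1, h2, h3, h4, leftRegular_leftRegular]
  simp

end Twist

/-! ### Linear combinations of functionals and polarization -/

theorem StrongDual.eq_sum_smul {V : Type*} [NormedAddCommGroup V] [NormedSpace ℂ V] {κ : Type*}
    [Fintype κ] {φ : StrongDual ℂ V} {c : κ → ℂ} {ψ : κ → StrongDual ℂ V}
    (h : ∀ T, φ T = ∑ i, c i * ψ i T) : φ = ∑ i, c i • ψ i := by
  ext T
  simp [h T]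

theorem StrongDual.eq_smul {V : Type*} [NormedAddCommGroup V] [NormedSpace ℂ V]
    {φ ψ : StrongDual ℂ V} {c : ℂ} (h : ∀ T, φ T = c * ψ T) : φ = c • ψ := by
  ext T
  simp [h T]

theorem Submodule.mem_of_forall_eq_mul {V : Type*} [NormedAddCommGroup V] [NormedSpace ℂ V]
    {M : Submodule ℂ (StrongDual ℂ V)}
    {φ ψ : StrongDual ℂ V} {c : ℂ} (h : ∀ T, φ T = c * ψ T) (hψ : ψ ∈ M) : φ ∈ M := by
  rw [StrongDual.eq_smul h]
  exact M.smul_mem c hψ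
  
theorem Submodule.mem_of_forall_eq_sum {V : Type*} [NormedAddCommGroup V] [NormedSpace ℂ V]
    {M : Submodule ℂ (StrongDual ℂ V)} {κ : Type*}
    [Fintype κ] {φ : StrongDual ℂ V} {c : κ → ℂ} {ψ : κ → StrongDual ℂ V}
    (h : ∀ T, φ T = ∑ i, c i * ψ i T) (hψ : ∀ i, ψ i ∈ M) : φ ∈ M := by
  rw [StrongDual.eq_sum_smul h]
  exact M.sum_mem fun i _ => M.smul_mem _ (hψ i)

theorem inner_map_polarization_right {E : Type*} [NormedAddCommGroup E] [InnerProductSpace ℂ E]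
    (A : E →L[ℂ] E) (F K : E) : inner ℂ K (A F) =
      (1 / 4 : ℂ) * (inner ℂ (F + K) (A (F + K)) - inner ℂ (F - K) (A (F - K))
      + Complex.I * inner ℂ (F + Complex.I • K) (A (F + Complex.I • K))
      - Complex.I * inner ℂ (F - Complex.I • K) (A (F - Complex.I • K))) := by
  simp only [map_add, map_sub, map_smul, inner_add_left, inner_add_right,
    inner_sub_left, inner_sub_right, inner_smul_left, inner_smul_right, Complex.conj_I]
  ring_nf
  simp only [Complex.I_sq]
  ring

theorem exists_unit_inner_map {E : Type*} [NormedAddCommGroup E] [InnerProductSpace ℂ E]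
    {F : E} (hF : F ≠ 0) : ∃ (c : ℂ) (F' : E), ‖F'‖ = 1 ∧
      ∀ A : E →L[ℂ] E, inner ℂ F (A F) = c * inner ℂ F' (A F') := by
  have : (‖F‖ : ℂ) ≠ 0 := by exact_mod_cast norm_ne_zero_iff.2 hF
  refine ⟨((‖F‖ ^ 2 : ℝ) : ℂ), ((‖F‖⁻¹ : ℝ) : ℂ) • F, ?_, fun A => ?_⟩
  · rw [norm_smul]; simp [norm_ne_zero_iff.2 hF]
  simp only [map_smul, inner_smul_left, inner_smul_right, Complex.conj_ofReal]
  push_cast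
  field_simp

theorem exists_polarization {E : Type*} [NormedAddCommGroup E] [InnerProductSpace ℂ E]
    (F K : E) : ∃ (c : Fin 4 → ℂ) (L : Fin 4 → E),
      ∀ A : E →L[ℂ] E, inner ℂ K (A F) = ∑ i, c i * inner ℂ (L i) (A (L i)) := by
  refine ⟨![1 / 4, -1 / 4, Complex.I / 4, -Complex.I / 4],
    ![F + K, F - K, F + Complex.I • K, F - Complex.I • K], fun A => ?_⟩
  rw [inner_map_polarization_right A F K]
  simp [Fin.sum_univ_four]
  ring

/-! ### Normal functionals on `VN(G)` and the Fourier algebra -/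

section NormalFunctionals

variable {G : Type u} [Group G] [TopologicalSpace G] [IsTopologicalGroup G]
  [MeasurableSpace G] [BorelSpace G] (ν : Measure G) [ν.IsHaarMeasure]

theorem mem_VN_iff {T : Lp ℂ 2 ν →L[ℂ] Lp ℂ 2 ν} :
    T ∈ VN ν ↔ T ∈ Set.centralizer (Set.centralizer (Set.range (leftRegular ν))) := by
  rw [← coe_groupVN]
  rfl

theorem isClosed_VN : IsClosed (VN ν : Set (Lp ℂ 2 ν →L[ℂ] Lp ℂ 2 ν)) := by
  have : (VN ν : Set (Lp ℂ 2 ν →L[ℂ] Lp ℂ 2 ν)) =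
      Set.centralizer (Set.centralizer (Set.range (leftRegular ν))) :=
    Set.ext fun T => mem_VN_iff ν
  rw [this]
  exact Set.isClosed_centralizer _

variable {ι : Type*}

/-- The functional `T ↦ ∑ᵢ ⟨T Fᵢ, Kᵢ⟩` on `VN(G)`. -/
def pairVN (F K : lp (fun _ : ι => Lp ℂ 2 ν) 2) : StrongDual ℂ (VN ν) :=
  LinearMap.mkContinuous
    { toFun := fun T => inner ℂ K (amp ι (T : Lp ℂ 2 ν →L[ℂ] Lp ℂ 2 ν) F)
      map_add' := fun S T => by
        simp [amp_add]
      map_smul' := fun c T => by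
        simp [amp_smul] }
    (‖F‖ * ‖K‖) fun T => by
      refine (norm_inner_le_norm (𝕜 := ℂ) K _).trans ?_
      calc ‖K‖ * ‖amp ι (T : Lp ℂ 2 ν →L[ℂ] Lp ℂ 2 ν) F‖
          ≤ ‖K‖ * (‖(T : Lp ℂ 2 ν →L[ℂ] Lp ℂ 2 ν)‖ * ‖F‖) := by
            gcongr; exact norm_amp_apply_le _ _
        _ = ‖F‖ * ‖K‖ * ‖T‖ := by
            change _ = ‖F‖ * ‖K‖ * ‖(T : Lp ℂ 2 ν →L[ℂ] Lp ℂ 2 ν)‖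
            ring

theorem pairVN_apply (F K : lp (fun _ : ι => Lp ℂ 2 ν) 2) (T : VN ν) :
    pairVN ν F K T = inner ℂ K (amp ι (T : Lp ℂ 2 ν →L[ℂ] Lp ℂ 2 ν) F) := rfl

theorem hasSum_pairVN (F K : lp (fun _ : ι => Lp ℂ 2 ν) 2) (T : VN ν) :
    HasSum (fun i => inner ℂ (K i) ((T : Lp ℂ 2 ν →L[ℂ] Lp ℂ 2 ν) (F i))) (pairVN ν F K T) :=
  lp.hasSum_inner K (amp ι (T : Lp ℂ 2 ν →L[ℂ] Lp ℂ 2 ν) F)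

/-- A square-summable family has countable support, so an arbitrary index set can be replaced by
`ℕ`. Indices with `F i = 0` contribute nothing, so `K` may be cut down to the support of `F`. -/
theorem isNormalFunctional_pairVN (F K : lp (fun _ : ι => Lp ℂ 2 ν) 2) :
    IsNormalFunctional ν (pairVN ν F K) := by
  let S : Set ι := Function.support fun i => ‖F i‖ ^ 2
  have hS : S.Countable := (lp_two_summable F).countable_support
  have : Countable S := hS
  obtain ⟨e, he⟩ := exists_injective_nat S
  have hsq (L : lp (fun _ : ι => Lp ℂ 2 ν) 2) :
      Summable fun n => ‖Function.extend e (fun i : S => L i) 0 n‖ ^ 2 := by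
    have h1 : Summable (Function.extend e (fun i : S => ‖L i‖ ^ 2) 0) :=
      (summable_extend_zero he).2 ((lp_two_summable L).subtype S)
    refine h1.congr fun n => ?_
    by_cases hn : ∃ i, e i = n
    · obtain ⟨i, rfl⟩ := hn
      rw [he.extend_apply, he.extend_apply]
    · rw [Function.extend_apply' _ _ _ hn, Function.extend_apply' _ _ _ hn]
      simp
  refine ⟨_, _, hsq F, hsq K, fun T => ?_⟩
  have h2 : HasSum (fun i : S => inner ℂ (K i) ((T : Lp ℂ 2 ν →L[ℂ] Lp ℂ 2 ν) (F i)))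
      (pairVN ν F K T) := by
    refine (hasSum_subtype_iff_of_support_subset ?_).2 (hasSum_pairVN ν F K T)
    intro i hi
    simp only [Function.mem_support, S] at hi ⊢
    contrapose! hi
    have : F i = 0 := by simpa using hi
    simp [this]
  convert! (hasSum_extend_zero he).2 h2 using 1
  funext n
  by_cases hn : ∃ i, e i = n
  · obtain ⟨i, rfl⟩ := hn
    rw [he.extend_apply, he.extend_apply, he.extend_apply]
  · rw [Function.extend_apply' _ _ _ hn, Function.extend_apply' _ _ _ hn,
      Function.extend_apply' _ _ _ hn]
    simp

theorem isNormalFunctional_of_hasSum {f g : ι → Lp ℂ 2 ν} (hf : Summable fun i => ‖f i‖ ^ 2)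
    (hg : Summable fun i => ‖g i‖ ^ 2) {φ : StrongDual ℂ (VN ν)}
    (h : ∀ T : VN ν, HasSum
      (fun i => inner ℂ (g i) ((T : Lp ℂ 2 ν →L[ℂ] Lp ℂ 2 ν) (f i))) (φ T)) :
    IsNormalFunctional ν φ := by
  have : φ = pairVN ν (toHilbertSum f hf) (toHilbertSum g hg) := by
    refine ContinuousLinearMap.ext fun T => ?_
    have h2 := hasSum_pairVN ν (toHilbertSum f hf) (toHilbertSum g hg) T
    simp only [toHilbertSum_apply] at h2
    exact (h T).unique h2
  rw [this]
  exact isNormalFunctional_pairVN ν _ _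

/-- The normal functionals on `VN(G)`, as a subspace of the dual. -/
def normalFunctionals : Submodule ℂ (StrongDual ℂ (VN ν)) where
  carrier := {φ | IsNormalFunctional ν φ}
  zero_mem' := by
    refine ⟨0, 0, ?_, ?_, fun T => ?_⟩ <;> simp [summable_zero, hasSum_zero]
  add_mem' := by
    rintro φ ψ ⟨f, g, hf, hg, h⟩ ⟨f', g', hf', hg', h'⟩
    refine isNormalFunctional_of_hasSum ν (f := Sum.elim f f') (g := Sum.elim g g')
      ?_ ?_ fun T => ?_
    · exact Summable.sum (f := fun i => ‖Sum.elim f f' i‖ ^ 2) hf hf'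
    · exact Summable.sum (f := fun i => ‖Sum.elim g g' i‖ ^ 2) hg hg'
    · exact HasSum.sum (f := fun i => inner ℂ (Sum.elim g g' i)
        ((T : Lp ℂ 2 ν →L[ℂ] Lp ℂ 2 ν) (Sum.elim f f' i))) (h T) (h' T)
  smul_mem' := by
    rintro c φ ⟨f, g, hf, hg, h⟩
    refine ⟨fun n => c • f n, g, ?_, hg, fun T => ?_⟩
    · simp only [norm_smul, mul_pow]
      exact hf.mul_left _
    · simpa [inner_smul_right] using (h T).mul_left c

theorem IsNormalFunctional.exists_eq_pairVN {φ : StrongDual ℂ (VN ν)}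
    (hφ : IsNormalFunctional ν φ) :
    ∃ F K : lp (fun _ : ℕ => Lp ℂ 2 ν) 2, φ = pairVN ν F K := by
  obtain ⟨f, g, hf, hg, h⟩ := hφ
  refine ⟨toHilbertSum f hf, toHilbertSum g hg, ?_⟩
  refine ContinuousLinearMap.ext fun T => ?_
  have h2 := hasSum_pairVN ν (toHilbertSum f hf) (toHilbertSum g hg) T
  simp only [toHilbertSum_apply] at h2
  exact (h T).unique h2

/-- A normal functional on `VN(G)` is determined by its values on the operators `λ(x)`. -/
theorem IsNormalFunctional.eq_zero {φ : StrongDual ℂ (VN ν)}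
    (hφ : IsNormalFunctional ν φ) (h : ∀ x, φ (lam ν x) = 0) : φ = 0 := by
  obtain ⟨F, K, rfl⟩ := hφ.exists_eq_pairVN
  refine ContinuousLinearMap.ext fun T => ?_
  refine inner_amp_eq_zero_of_mem_bicommutant (leftRegular ν) (fun x y => ?_)
    (leftRegular_one ν) (leftRegular_star ν) ((mem_VN_iff ν).1 T.2) F K h
  ext1 f
  exact (leftRegular_leftRegular ν x y f).symm

theorem IsNormalFunctional.ext {φ ψ : StrongDual ℂ (VN ν)}
    (hφ : IsNormalFunctional ν φ) (hψ : IsNormalFunctional ν ψ)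
    (h : ∀ x, φ (lam ν x) = ψ (lam ν x)) : φ = ψ := by
  have h1 : φ - ψ ∈ normalFunctionals ν :=
    (normalFunctionals ν).sub_mem hφ hψ
  rw [← sub_eq_zero]
  exact IsNormalFunctional.eq_zero ν h1 fun x => by simp [h x]

theorem isMean_pairVN {F : lp (fun _ : ι => Lp ℂ 2 ν) 2} (hF : ‖F‖ = 1) :
    IsMean ν (pairVN ν F F) := by
  constructor
  · have : ((1 : VN ν) : Lp ℂ 2 ν →L[ℂ] Lp ℂ 2 ν) = 1 := rfl
    rw [pairVN_apply, this, amp_one, one_apply_eq_self, inner_self_eq_norm_sq_to_K, hF]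
    simp
  · intro T hT
    refine (hasSum_pairVN ν F F T).nonneg fun i => ?_
    exact hT.inner_nonneg_right _

theorem pairVN_self_mem_fourierAlgebra (F : lp (fun _ : ι => Lp ℂ 2 ν) 2) :
    pairVN ν F F ∈ fourierAlgebra ν := by
  by_cases hF : F = 0
  · have : pairVN ν F F = 0 := ContinuousLinearMap.ext fun T => by simp [pairVN_apply, hF]
    rw [this]
    exact zero_mem _
  obtain ⟨c, F', hF', h⟩ := exists_unit_inner_map hF
  have h3 : pairVN ν F' F' ∈ fourierAlgebra ν := Submodule.subset_span
      ⟨isMean_pairVN ν hF', isNormalFunctional_pairVN ν _ _⟩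
  have h2 : ∀ T, pairVN ν F F T = c * pairVN ν F' F' T := fun T => h (amp ι T.1)
  exact Submodule.mem_of_forall_eq_mul h2 h3

/-- The Fourier algebra consists of all normal functionals. -/
theorem fourierAlgebra_eq : fourierAlgebra ν = normalFunctionals ν := by
  refine le_antisymm (Submodule.span_le.2 fun φ hφ => hφ.2) fun φ hφ => ?_
  obtain ⟨F, K, rfl⟩ := hφ.exists_eq_pairVN
  obtain ⟨c, L, h⟩ := exists_polarization F K
  have h2 : ∀ T, pairVN ν F K T = ∑ i, c i * pairVN ν (L i) (L i) T := fun T => h (amp ℕ T.1)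
  exact Submodule.mem_of_forall_eq_sum h2 fun i => pairVN_self_mem_fourierAlgebra ν (L i)

end NormalFunctionals

/-! ### Iterated Hilbert sums -/

section Flatten

variable {H : Type*} [NormedAddCommGroup H] {A I : Type*}

theorem summable_norm_sq_flatten (L : A → lp (fun _ : I => H) 2)
    (hL : Summable fun a => ‖L a‖ ^ 2) : Summable fun p : A × I => ‖L p.1 p.2‖ ^ 2 := by
  rw [summable_prod_of_nonneg (fun _ => by positivity)]
  exact ⟨fun a => lp_two_summable (L a), hL.congr fun a => lp_two_norm_sq (L a)⟩

/-- A square-summable family of vectors in a Hilbert sum, as one vector of a larger sum. -/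
def flatten (L : A → lp (fun _ : I => H) 2) (hL : Summable fun a => ‖L a‖ ^ 2) :
    lp (fun _ : A × I => H) 2 :=
  toHilbertSum (fun p => L p.1 p.2) (summable_norm_sq_flatten L hL)

theorem hasSum_inner_amp_flatten [InnerProductSpace ℂ H] (L M : A → lp (fun _ : I => H) 2)
    (hL : Summable fun a => ‖L a‖ ^ 2) (hM : Summable fun a => ‖M a‖ ^ 2) (T : H →L[ℂ] H) :
    HasSum (fun a => inner ℂ (M a) (amp I T (L a)))
      (inner ℂ (flatten M hM) (amp (A × I) T (flatten L hL))) := by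
  have h := lp.hasSum_inner (𝕜 := ℂ) (flatten M hM) (amp (A × I) T (flatten L hL))
  exact h.prod_fiberwise fun a => lp.hasSum_inner (𝕜 := ℂ) (M a) (amp I T (L a))

end Flatten

theorem HasSum.inner_apply {H : Type*} [NormedAddCommGroup H] [InnerProductSpace ℂ H] {A : Type*}
    {S : A → H →L[ℂ] H} {T : H →L[ℂ] H} (hS : HasSum S T) (k h : H) :
    HasSum (fun a => inner ℂ k (S a h)) (inner ℂ k (T h)) :=
  ((innerSL ℂ k).comp (ContinuousLinearMap.apply ℂ H h)).hasSum hS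

theorem summable_norm_mul_norm {H : Type*} [NormedAddCommGroup H] {ι : Type*}
    (F K : lp (fun _ : ι => H) 2) : Summable fun n => ‖F n‖ * ‖K n‖ := by
  refine Summable.of_nonneg_of_le (fun _ => by positivity) (fun n => ?_)
    ((lp_two_summable F).add (lp_two_summable K))
  nlinarith [sq_nonneg (‖F n‖ - ‖K n‖), sq_nonneg (‖F n‖), sq_nonneg (‖K n‖)]

/-! ### The action of the Fourier algebra on `VN(G)` -/

section Slice

variable {G : Type u} [Group G] [TopologicalSpace G] [IsTopologicalGroup G]
  [MeasurableSpace G] [BorelSpace G] (ν : Measure G) [ν.IsHaarMeasure]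

/-- The index set of a fixed Hilbert basis of `L²(G)`. -/
def hbIndex : Set (Lp ℂ 2 ν) := (exists_hilbertBasis ℂ (Lp ℂ 2 ν)).choose

/-- A fixed Hilbert basis of `L²(G)`. -/
def hb : HilbertBasis (hbIndex ν) ℂ (Lp ℂ 2 ν) :=
  (exists_hilbertBasis ℂ (Lp ℂ 2 ν)).choose_spec.choose

variable [LocallyCompactSpace G] [ν.Regular]

/-- The coordinates of `s ↦ f(s) λ(s⁻¹)h`, as a bounded linear function of `h`. -/
def twistCLM (f : Lp ℂ 2 ν) : Lp ℂ 2 ν →L[ℂ] lp (fun _ : hbIndex ν => Lp ℂ 2 ν) 2 :=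
  LinearMap.mkContinuous
    { toFun := fun h => coords ν (hb ν) (twist ν f h)
      map_add' := fun h k => by rw [twist_add_right, map_add]
      map_smul' := fun c h => by rw [twist_smul_right, map_smul, RingHom.id_apply] }
    ‖f‖ fun h => by
      change ‖coords ν (hb ν) (twist ν f h)‖ ≤ _
      rw [LinearIsometryEquiv.norm_map, norm_twist]

theorem twistCLM_apply (f h : Lp ℂ 2 ν) : twistCLM ν f h = coords ν (hb ν) (twist ν f h) := rfl

theorem norm_twistCLM_apply (f h : Lp ℂ 2 ν) : ‖twistCLM ν f h‖ = ‖f‖ * ‖h‖ := by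
  rw [twistCLM_apply, LinearIsometryEquiv.norm_map, norm_twist]

theorem norm_twistCLM_le (f : Lp ℂ 2 ν) : ‖twistCLM ν f‖ ≤ ‖f‖ :=
  LinearMap.mkContinuous_norm_le _ (norm_nonneg _) _

/-- Fell absorption at the level of matrix coefficients: the amplified `λ(x)` acts diagonally on
twisted vectors, so its coefficient is a pointwise product of two coefficients. -/
theorem inner_twistCLM_amp_leftRegular (f g h k : Lp ℂ 2 ν) (x : G) :
    inner ℂ (twistCLM ν g k) (amp _ (leftRegular ν x) (twistCLM ν f h)) =
      inner ℂ g (leftRegular ν x f) * inner ℂ k (leftRegular ν x h) := by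
  rw [twistCLM_apply, twistCLM_apply, amp_coords_twist, LinearIsometryEquiv.inner_map_map,
    inner_twist_twist]

/-- The action of the vector functional `T ↦ ⟨T f, g⟩` of the Fourier algebra on operators. -/
def slice (f g : Lp ℂ 2 ν) (T : Lp ℂ 2 ν →L[ℂ] Lp ℂ 2 ν) : Lp ℂ 2 ν →L[ℂ] Lp ℂ 2 ν :=
  (ContinuousLinearMap.adjoint (twistCLM ν g)).comp ((amp _ T).comp (twistCLM ν f))

theorem inner_slice (f g h k : Lp ℂ 2 ν) (T : Lp ℂ 2 ν →L[ℂ] Lp ℂ 2 ν) :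
    inner ℂ k (slice ν f g T h) = inner ℂ (twistCLM ν g k) (amp _ T (twistCLM ν f h)) := by
  rw [slice, ContinuousLinearMap.comp_apply, ContinuousLinearMap.adjoint_inner_right]
  rfl

theorem norm_slice_le (f g : Lp ℂ 2 ν) (T : Lp ℂ 2 ν →L[ℂ] Lp ℂ 2 ν) :
    ‖slice ν f g T‖ ≤ ‖f‖ * ‖g‖ * ‖T‖ := by
  refine ContinuousLinearMap.opNorm_le_bound _ (by positivity) fun h => ?_
  refine (ContinuousLinearMap.le_opNorm (ContinuousLinearMap.adjoint (twistCLM ν g)) _).trans ?_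
  rw [LinearIsometryEquiv.norm_map]
  calc ‖twistCLM ν g‖ * ‖amp _ T (twistCLM ν f h)‖
      ≤ ‖g‖ * (‖T‖ * ‖twistCLM ν f h‖) := by
        gcongr
        · exact norm_twistCLM_le ν g
        · exact norm_amp_apply_le _ _
    _ = ‖f‖ * ‖g‖ * ‖T‖ * ‖h‖ := by rw [norm_twistCLM_apply]; ring

theorem inner_slice_eq_pairVN (f g h k : Lp ℂ 2 ν) (T : VN ν) :
    inner ℂ k (slice ν f g T h) = pairVN ν (twistCLM ν f h) (twistCLM ν g k) T :=
  inner_slice ν f g h k T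

theorem pairVN_twistCLM_lam (f g h k : Lp ℂ 2 ν) (x : G) :
    pairVN ν (twistCLM ν f h) (twistCLM ν g k) (lam ν x) =
      inner ℂ g (leftRegular ν x f) * inner ℂ k (leftRegular ν x h) :=
  inner_twistCLM_amp_leftRegular ν f g h k x

/-- Commutativity of the Fourier algebra, in terms of its action on `VN(G)`. -/
theorem inner_slice_comm (f g h k : Lp ℂ 2 ν) (T : VN ν) :
    inner ℂ k (slice ν f g T h) = inner ℂ g (slice ν h k T f) := by
  rw [inner_slice_eq_pairVN, inner_slice_eq_pairVN]
  have : pairVN ν (twistCLM ν f h) (twistCLM ν g k) =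
      pairVN ν (twistCLM ν h f) (twistCLM ν k g) :=
    IsNormalFunctional.ext ν (isNormalFunctional_pairVN ν _ _) (isNormalFunctional_pairVN ν _ _)
      fun x => by rw [pairVN_twistCLM_lam, pairVN_twistCLM_lam, mul_comm]
  rw [this]

/-- For `A` in the commutant of `λ`, the matrix coefficients of `A * slice` and `slice * A` are
normal functionals of `T`, and they agree at each `λ(x)` because `A` commutes with `λ(x)`. -/
theorem slice_mem_VN (f g : Lp ℂ 2 ν) (T : VN ν) : slice ν f g T ∈ VN ν := by
  rw [mem_VN_iff, Set.mem_centralizer_iff]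
  intro A hA
  ext1 h
  refine ext_inner_left ℂ fun k => ?_
  rw [mul_apply_eq_comp, mul_apply_eq_comp, ← ContinuousLinearMap.adjoint_inner_left,
    inner_slice_eq_pairVN, inner_slice_eq_pairVN]
  have : pairVN ν (twistCLM ν f h) (twistCLM ν g (ContinuousLinearMap.adjoint A k)) =
      pairVN ν (twistCLM ν f (A h)) (twistCLM ν g k) :=
    IsNormalFunctional.ext ν (isNormalFunctional_pairVN ν _ _) (isNormalFunctional_pairVN ν _ _)
      fun x => by
        rw [pairVN_twistCLM_lam, pairVN_twistCLM_lam, ContinuousLinearMap.adjoint_inner_left]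
        have hx := (Set.mem_centralizer_iff.1 hA) _ ⟨x, rfl⟩
        have hx' := congrArg (fun B : Lp ℂ 2 ν →L[ℂ] Lp ℂ 2 ν => B h) hx
        simp only [mul_apply_eq_comp] at hx'
        rw [hx']
  rw [this]

variable (F K : lp (fun _ : ℕ => Lp ℂ 2 ν) 2)

/-- The action of the functional `T ↦ ∑ₙ ⟨T Fₙ, Kₙ⟩` of the Fourier algebra on operators. -/
def act (T : Lp ℂ 2 ν →L[ℂ] Lp ℂ 2 ν) : Lp ℂ 2 ν →L[ℂ] Lp ℂ 2 ν :=
  ∑' n, slice ν (F n) (K n) T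

theorem hasSum_act (T : Lp ℂ 2 ν →L[ℂ] Lp ℂ 2 ν) :
    HasSum (fun n => slice ν (F n) (K n) T) (act ν F K T) := by
  refine Summable.hasSum (Summable.of_norm_bounded (g := fun n => ‖F n‖ * ‖K n‖ * ‖T‖) ?_ ?_)
  · exact (summable_norm_mul_norm F K).mul_right _
  · exact fun n => norm_slice_le ν _ _ _

theorem hasSum_inner_act (T : Lp ℂ 2 ν →L[ℂ] Lp ℂ 2 ν) (h k : Lp ℂ 2 ν) :
    HasSum (fun n => inner ℂ k (slice ν (F n) (K n) T h)) (inner ℂ k (act ν F K T h)) :=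
  (hasSum_act ν F K T).inner_apply k h

theorem act_mem_VN (T : VN ν) : act ν F K T ∈ VN ν :=
  (isClosed_VN ν).mem_of_tendsto (hasSum_act ν F K T) (.of_forall fun _ =>
    sum_mem fun _ _ => slice_mem_VN ν _ _ T)

omit [LocallyCompactSpace G] [ν.Regular] in
theorem hasSum_pairVN_lam {ι : Type*} (F K : lp (fun _ : ι => Lp ℂ 2 ν) 2) (x : G) :
    HasSum (fun n => inner ℂ (K n) (leftRegular ν x (F n))) (pairVN ν F K (lam ν x)) :=
  hasSum_pairVN ν F K (lam ν x)

/-- The product of two elements of the Fourier algebra. -/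
theorem exists_fourierMul (F' K' : lp (fun _ : ℕ => Lp ℂ 2 ν) 2) :
    ∃ w ∈ fourierAlgebra ν, IsFourierMul ν (pairVN ν F K) (pairVN ν F' K') w ∧
      ∀ T : VN ν, pairVN ν F' K' ⟨act ν F K T, act_mem_VN ν F K T⟩ = w T := by
  have hs (F F' : lp (fun _ : ℕ => Lp ℂ 2 ν) 2) :
      Summable fun p : ℕ × ℕ => ‖twistCLM ν (F p.2) (F' p.1)‖ ^ 2 := by
    simp only [norm_twistCLM_apply, mul_pow, mul_comm (‖F _‖ ^ 2)]
    exact (lp_two_summable F').mul_of_nonneg (lp_two_summable F) (fun _ => by positivity)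
      (fun _ => by positivity)
  -- The product is a single vector functional over pairs `(m, n)`, with `m` indexing `F', K'` and
  -- `n` indexing `F, K`. Summing over `n` first produces the value of `u` at `λ(x)`, respectively a
  -- coefficient of `u T`.
  refine ⟨pairVN ν (flatten _ (hs F F')) (flatten _ (hs K K')), ?_, fun x => ?_, fun T => ?_⟩
  · rw [fourierAlgebra_eq]
    exact isNormalFunctional_pairVN ν _ _
  · have h1 := hasSum_inner_amp_flatten _ _ (hs F F') (hs K K') (leftRegular ν x)
    simp only [inner_twistCLM_amp_leftRegular] at h1
    have h2 := HasSum.prod_fiberwise h1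
      (fun m => HasSum.mul_right (inner ℂ (K' m) (leftRegular ν x (F' m)))
        (hasSum_pairVN_lam ν F K x))
    exact h2.unique (HasSum.mul_left (pairVN ν F K (lam ν x)) (hasSum_pairVN_lam ν F' K' x))
  · have h1 := hasSum_inner_amp_flatten _ _ (hs F F') (hs K K') T.1
    simp only [← inner_slice] at h1
    have h2 := HasSum.prod_fiberwise h1 (fun m => hasSum_inner_act ν F K T.1 (F' m) (K' m))
    exact (hasSum_pairVN ν F' K' ⟨act ν F K T, act_mem_VN ν F K T⟩).unique h2

theorem isFourierSMul_act (T : VN ν) :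
    IsFourierSMul ν (pairVN ν F K) T ⟨act ν F K T, act_mem_VN ν F K T⟩ := by
  intro v hv
  rw [fourierAlgebra_eq] at hv
  obtain ⟨F', K', rfl⟩ := IsNormalFunctional.exists_eq_pairVN ν hv
  obtain ⟨w, hw, h1, h2⟩ := exists_fourierMul ν F K F' K'
  exact ⟨w, hw, h1, h2 T⟩

end Slice

theorem norm_inner_map_sub_le {H : Type*} [NormedAddCommGroup H] [InnerProductSpace ℂ H]
    (A : H →L[ℂ] H) {C ε a b : ℝ} (hA : ∀ x, ‖A x‖ ≤ C * ‖x‖) (hC : 0 ≤ C) {x y x' y' : H}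
    (hx : ‖x‖ ≤ a) (hy : ‖y'‖ ≤ b) (hxx : ‖x - x'‖ ≤ ε) (hyy : ‖y - y'‖ ≤ ε) :
    ‖inner ℂ y (A x) - inner ℂ y' (A x')‖ ≤ C * (a + b) * ε := by
  have hε : 0 ≤ ε := (norm_nonneg _).trans hxx
  have ha : 0 ≤ a := (norm_nonneg _).trans hx
  have hb : 0 ≤ b := (norm_nonneg _).trans hy
  have : inner ℂ y (A x) - inner ℂ y' (A x') =
      inner ℂ (y - y') (A x) + inner ℂ y' (A (x - x')) := by
    rw [inner_sub_left, map_sub, inner_sub_right]; ring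
  rw [this]
  calc _ ≤ ‖y - y'‖ * ‖A x‖ + ‖y'‖ * ‖A (x - x')‖ :=
        (norm_add_le _ _).trans (add_le_add (norm_inner_le_norm _ _) (norm_inner_le_norm _ _))
    _ ≤ ε * (C * a) + b * (C * ε) := by
        gcongr
        · exact (hA x).trans (by gcongr)
        · exact (hA _).trans (by gcongr)
    _ = _ := by ring

/-- A uniformly bounded family of functionals converges pointwise along any ultrafilter. -/
theorem exists_strongDual_ultrafilter_lim {V : Type*} [NormedAddCommGroup V] [NormedSpace ℂ V]
    {Γ : Type*} (p : Ultrafilter Γ) (φ : Γ → StrongDual ℂ V) {C : ℝ}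
    (hφ : ∀ γ T, ‖φ γ T‖ ≤ C * ‖T‖) :
    ∃ m : StrongDual ℂ V, ∀ T, Filter.Tendsto (fun γ => φ γ T) p (𝓝 (m T)) := by
  have h : ∀ T, ∃ z ∈ Metric.closedBall (0 : ℂ) (C * ‖T‖),
      Filter.Tendsto (fun γ => φ γ T) p (𝓝 z) := by
    intro T
    obtain ⟨z, hz, hlim⟩ := (isCompact_closedBall (0 : ℂ) (C * ‖T‖)).ultrafilter_le_nhds
      (p.map fun γ => φ γ T) (by
        rw [Filter.le_principal_iff]
        exact Filter.mem_map.2 (Filter.univ_mem' fun γ => by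
          simpa using hφ γ T))
    exact ⟨z, hz, hlim⟩
  choose m hm hlim using h
  refine ⟨LinearMap.mkContinuous
    { toFun := m
      map_add' := fun S T => tendsto_nhds_unique (hlim (S + T)) (by
        simpa using (hlim S).add (hlim T))
      map_smul' := fun c T => tendsto_nhds_unique (hlim (c • T)) (by
        simpa using (hlim T).const_mul c) } C fun T => by simpa using hm T, hlim⟩

/-! ### Asymptotic invariance of vector states near the identity -/

section NearInvariance

variable {G : Type u} [Group G] [TopologicalSpace G] [IsTopologicalGroup G]
  [MeasurableSpace G] [BorelSpace G] (ν : Measure G) [ν.IsHaarMeasure]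

/-- The vector functional `T ↦ ⟨T f, g⟩` on `VN(G)`. -/
def vecVN (f g : Lp ℂ 2 ν) : StrongDual ℂ (VN ν) :=
  LinearMap.mkContinuous
    { toFun := fun T => inner ℂ g ((T : Lp ℂ 2 ν →L[ℂ] Lp ℂ 2 ν) f)
      map_add' := fun S T => by simp [inner_add_right]
      map_smul' := fun c T => by simp [inner_smul_right] }
    (‖f‖ * ‖g‖) fun T => by
      refine (norm_inner_le_norm (𝕜 := ℂ) g _).trans ?_
      calc ‖g‖ * ‖(T : Lp ℂ 2 ν →L[ℂ] Lp ℂ 2 ν) f‖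
          ≤ ‖g‖ * (‖(T : Lp ℂ 2 ν →L[ℂ] Lp ℂ 2 ν)‖ * ‖f‖) := by
            gcongr; exact ContinuousLinearMap.le_opNorm _ _
        _ = ‖f‖ * ‖g‖ * ‖T‖ := by
            change _ = ‖f‖ * ‖g‖ * ‖(T : Lp ℂ 2 ν →L[ℂ] Lp ℂ 2 ν)‖
            ring

theorem vecVN_apply (f g : Lp ℂ 2 ν) (T : VN ν) :
    vecVN ν f g T = inner ℂ g ((T : Lp ℂ 2 ν →L[ℂ] Lp ℂ 2 ν) f) := rfl

theorem norm_vecVN_apply_le (f g : Lp ℂ 2 ν) (T : VN ν) :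
    ‖vecVN ν f g T‖ ≤ ‖f‖ * ‖g‖ * ‖T‖ :=
  (vecVN ν f g).le_of_opNorm_le (LinearMap.mkContinuous_norm_le _ (by positivity) _) T

theorem isNormalFunctional_vecVN (f g : Lp ℂ 2 ν) : IsNormalFunctional ν (vecVN ν f g) := by
  refine isNormalFunctional_of_hasSum ν (ι := Unit) (f := fun _ => f) (g := fun _ => g)
    (Summable.of_finite) (Summable.of_finite) fun T => ?_
  exact hasSum_unique fun _ : Unit => inner ℂ g ((T : Lp ℂ 2 ν →L[ℂ] Lp ℂ 2 ν) f)

theorem isMean_vecVN {f : Lp ℂ 2 ν} (hf : ‖f‖ = 1) : IsMean ν (vecVN ν f f) := by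
  constructor
  · have : ((1 : VN ν) : Lp ℂ 2 ν →L[ℂ] Lp ℂ 2 ν) = 1 := rfl
    rw [vecVN_apply, this, one_apply_eq_self, inner_self_eq_norm_sq_to_K, hf]
    simp
  · exact fun T hT => hT.inner_nonneg_right _

/-- The function `f` vanishes almost everywhere off `U`. -/
def SupportedIn (f : Lp ℂ 2 ν) (U : Set G) : Prop := ∀ᵐ s ∂ν, s ∉ U → f s = 0

variable {ν} in
omit [Group G] [TopologicalSpace G] [IsTopologicalGroup G] [BorelSpace G] [ν.IsHaarMeasure] in
theorem SupportedIn.mono {f : Lp ℂ 2 ν} {U V : Set G} (h : SupportedIn ν f U) (hUV : U ⊆ V) :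
    SupportedIn ν f V :=
  Filter.Eventually.mono h fun _ hs hV => hs fun hU => hV (hUV hU)

variable [LocallyCompactSpace G] [ν.Regular]

/-- Pointwise the difference is `f(s) (λ(s⁻¹)h - h)`, which vanishes off the support of `f` and is
small on it. -/
theorem norm_twist_sub_tens_le {f h : Lp ℂ 2 ν} {U : Set G} (hf : SupportedIn ν f U) {ε : ℝ}
    (hU : ∀ s ∈ U, ‖leftRegular ν s⁻¹ h - h‖ ≤ ε) :
    ‖twist ν f h - tens ν h f‖ ≤ ε * ‖f‖ := by
  refine Lp.norm_le_mul_norm_of_ae_le_mul ?_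
  filter_upwards [hf, coeFn_twist ν f h, coeFn_tens ν h f,
    Lp.coeFn_sub (twist ν f h) (tens ν h f)] with s h1 h2 h3 h4
  rw [h4, Pi.sub_apply, h2, h3, ← smul_sub, norm_smul, mul_comm]
  by_cases hs : s ∈ U
  · gcongr
    exact hU s hs
  · simp [h1 hs]

theorem inner_coords_tens_amp (f h k : Lp ℂ 2 ν) (T : Lp ℂ 2 ν →L[ℂ] Lp ℂ 2 ν) :
    inner ℂ (coords ν (hb ν) (tens ν k f)) (amp _ T (coords ν (hb ν) (tens ν h f))) =
      inner ℂ k h * inner ℂ f (T f) := by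
  have h1 := lp.hasSum_inner (𝕜 := ℂ) (coords ν (hb ν) (tens ν k f))
    (amp _ T (coords ν (hb ν) (tens ν h f)))
  refine h1.unique ?_
  have h2 := HasSum.mul_right (inner ℂ f (T f)) ((hb ν).hasSum_inner_mul_inner k h)
  convert! h2 using 1
  funext i
  rw [amp_apply, coords_tens, coords_tens, map_smul, inner_smul_left, inner_smul_right,
    inner_conj_symm]
  ring

/-- For `f` concentrated near the identity the twist is nearly the plain tensor, on which the
amplification of `T` acts in the `f` factor alone. So `slice ν f f T` is weakly close to the scalar
`⟨T f, f⟩`. -/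
theorem norm_inner_slice_sub_le {f h k : Lp ℂ 2 ν} (hf1 : ‖f‖ = 1) {U : Set G}
    (hf : SupportedIn ν f U) {ε : ℝ} (hU : ∀ s ∈ U, ‖leftRegular ν s⁻¹ h - h‖ ≤ ε)
    (hU' : ∀ s ∈ U, ‖leftRegular ν s⁻¹ k - k‖ ≤ ε) (T : Lp ℂ 2 ν →L[ℂ] Lp ℂ 2 ν) :
    ‖inner ℂ k (slice ν f f T h) - inner ℂ k h * inner ℂ f (T f)‖ ≤
      ‖T‖ * (‖h‖ + ‖k‖) * ε := by
  have hd {h : Lp ℂ 2 ν} (hU : ∀ s ∈ U, ‖leftRegular ν s⁻¹ h - h‖ ≤ ε) :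
      ‖twistCLM ν f h - coords ν (hb ν) (tens ν h f)‖ ≤ ε := by
    rw [twistCLM_apply, ← map_sub, LinearIsometryEquiv.norm_map]
    simpa [hf1] using norm_twist_sub_tens_le ν hf hU
  rw [inner_slice, ← inner_coords_tens_amp]
  refine norm_inner_map_sub_le (amp _ T) (norm_amp_apply_le T) (norm_nonneg T) ?_ ?_ (hd hU)
    (hd hU')
  · rw [norm_twistCLM_apply, hf1, one_mul]
  · rw [LinearIsometryEquiv.norm_map, norm_tens, hf1, one_mul]

variable {Γ : Type*} {l : Filter Γ} {f : Γ → Lp ℂ 2 ν}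

theorem tendsto_inner_slice_sub (hf1 : ∀ γ, ‖f γ‖ = 1)
    (hf : ∀ V ∈ 𝓝 (1 : G), ∀ᶠ γ in l, SupportedIn ν (f γ) V) (h k : Lp ℂ 2 ν)
    (T : VN ν) :
    Filter.Tendsto (fun γ => inner ℂ (f γ) (slice ν h k T (f γ)) -
      inner ℂ k h * inner ℂ (f γ) (T.1 (f γ))) l (𝓝 0) := by
  rw [Metric.tendsto_nhds]
  intro ε hε
  obtain ⟨δ, hδ, hδε⟩ : ∃ δ > 0, ‖T.1‖ * (‖h‖ + ‖k‖) * δ < ε := by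
    refine ⟨ε / (‖T.1‖ * (‖h‖ + ‖k‖) + 1), by positivity, ?_⟩
    rw [← mul_div_assoc, div_lt_iff₀ (by positivity)]
    nlinarith
  have hcont (h : Lp ℂ 2 ν) : {s : G | ‖leftRegular ν s⁻¹ h - h‖ ≤ δ} ∈ 𝓝 (1 : G) := by
    have hc : Continuous fun s : G => ‖leftRegular ν s⁻¹ h - h‖ :=
      (((continuous_leftRegular ν h).comp continuous_inv).sub continuous_const).norm
    refine (hc.tendsto 1).eventually (Iic_mem_nhds ?_)
    simp [leftRegular_one, hδ]
  filter_upwards [hf _ (Filter.inter_mem (hcont h) (hcont k))] with γ hγ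
  -- Commutativity of the Fourier algebra exchanges the roles: the moving vector `f γ` becomes the
  -- one that is twisted, with `h` and `k` fixed.
  rw [dist_zero_right, ← inner_slice_comm]
  exact (norm_inner_slice_sub_le ν (hf1 γ) hγ (fun s hs => hs.1) (fun s hs => hs.2) T.1).trans_lt
    hδε

theorem tendsto_inner_act_sub (hf1 : ∀ γ, ‖f γ‖ = 1)
    (hf : ∀ V ∈ 𝓝 (1 : G), ∀ᶠ γ in l, SupportedIn ν (f γ) V)
    (F K : lp (fun _ : ℕ => Lp ℂ 2 ν) 2) (T : VN ν) :
    Filter.Tendsto (fun γ => inner ℂ (f γ) (act ν F K T (f γ)) -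
      inner ℂ K F * inner ℂ (f γ) (T.1 (f γ))) l (𝓝 0) := by
  have h1 (γ : Γ) : HasSum (fun n => inner ℂ (f γ) (slice ν (F n) (K n) T (f γ)) -
      inner ℂ (K n) (F n) * inner ℂ (f γ) (T.1 (f γ))) (inner ℂ (f γ) (act ν F K T (f γ)) -
      inner ℂ K F * inner ℂ (f γ) (T.1 (f γ))) :=
    (hasSum_inner_act ν F K T.1 (f γ) (f γ)).sub 
      (HasSum.mul_right (inner ℂ (f γ) (T.1 (f γ))) (lp.hasSum_inner (𝕜 := ℂ) K F))
  have h2 (γ : Γ) := (h1 γ).tsum_eq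
  simp only [← h2]
  rw [← tsum_zero (α := ℂ) (β := ℕ)]
  refine tendsto_tsum_of_dominated_convergence
    (bound := fun n => ‖F n‖ * ‖K n‖ * (2 * ‖T.1‖))
    ((summable_norm_mul_norm F K).mul_right _)
    (fun n => tendsto_inner_slice_sub ν hf1 hf (F n) (K n) T) (.of_forall fun γ n => ?_)
  have hb (A : Lp ℂ 2 ν →L[ℂ] Lp ℂ 2 ν) : ‖(inner ℂ (f γ) (A (f γ)) : ℂ)‖ ≤ ‖A‖ := by
    refine (norm_inner_le_norm _ _).trans ?_
    simpa [hf1 γ] using A.le_opNorm (f γ)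
  calc _ ≤ ‖(inner ℂ (f γ) (slice ν (F n) (K n) T (f γ)) : ℂ)‖ +
        ‖inner ℂ (K n) (F n) * inner ℂ (f γ) (T.1 (f γ))‖ := norm_sub_le _ _
    _ ≤ ‖F n‖ * ‖K n‖ * ‖T.1‖ + ‖K n‖ * ‖F n‖ * ‖T.1‖ := by
        rw [norm_mul]
        gcongr
        · exact (hb _).trans (norm_slice_le ν _ _ _)
        · exact norm_inner_le_norm _ _
        · exact hb _
    _ = _ := by ring

/-- Limits of vector states concentrating at the identity are topological invariant means. -/
theorem exists_mem_TIM_of_ultrafilter {p : Ultrafilter Γ} (hf1 : ∀ γ, ‖f γ‖ = 1)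
    (hf : ∀ V ∈ 𝓝 (1 : G), ∀ᶠ γ in p, SupportedIn ν (f γ) V) :
    ∃ m ∈ TIM ν, ∀ T : VN ν,
      Filter.Tendsto (fun γ => inner ℂ (f γ) (T.1 (f γ))) p (𝓝 (m T)) := by
  obtain ⟨m, hm⟩ := exists_strongDual_ultrafilter_lim p (fun γ => vecVN ν (f γ) (f γ)) (C := 1)
    (fun γ T => by simpa [hf1 γ] using norm_vecVN_apply_le ν (f γ) (f γ) T)
  refine ⟨m, ⟨⟨?_, fun T hT => ?_⟩, fun u hu T => ?_⟩, hm⟩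
  · refine tendsto_nhds_unique (hm 1) (tendsto_const_nhds.congr fun γ => ?_)
    exact (isMean_vecVN ν (hf1 γ)).1.symm
  · exact ge_of_tendsto' (hm T) fun γ => (isMean_vecVN ν (hf1 γ)).2 T hT
  · obtain ⟨F, K, rfl⟩ := IsNormalFunctional.exists_eq_pairVN ν hu.2
    refine ⟨_, isFourierSMul_act ν F K T, ?_⟩
    -- This inner product is the value of the state `u` at the unit, so the scalar factor in the
    -- asymptotic formula disappears.
    have h1 : inner ℂ K F = (1 : ℂ) := by
      have h2 := hu.1.1
      have : ((1 : VN ν) : Lp ℂ 2 ν →L[ℂ] Lp ℂ 2 ν) = 1 := rfl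
      rwa [pairVN_apply, this, amp_one, one_apply_eq_self] at h2
    have h3 := tendsto_inner_act_sub ν hf1 hf F K T
    rw [h1] at h3
    have h4 := (hm ⟨act ν F K T, act_mem_VN ν F K T⟩).sub (hm T)
    refine sub_eq_zero.1 (tendsto_nhds_unique h4 (h3.congr fun γ => ?_))
    rw [one_mul]
    rfl

end NearInvariance

/-! ### Cardinality of neighbourhood bases -/

section Character

variable (G : Type u) [Group G] [TopologicalSpace G]

theorem exists_basis_card_eq_nbhdCharacter :
    ∃ B : Set (Set G), (𝓝 (1 : G)).HasBasis (fun U => U ∈ B) id ∧ #B = nbhdCharacter G := by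
  have hne : {c : Cardinal.{u} | ∃ B : Set (Set G),
      (𝓝 (1 : G)).HasBasis (fun U => U ∈ B) id ∧ #B = c}.Nonempty :=
    ⟨_, {U | U ∈ 𝓝 (1 : G)}, (𝓝 (1 : G)).basis_sets, rfl⟩
  exact csInf_mem hne

variable {G}

theorem nbhdCharacter_le_of_hasBasis {ι : Type u} {s : ι → Set G}
    (h : (𝓝 (1 : G)).HasBasis (fun _ : ι => True) s) : nbhdCharacter G ≤ #ι := by
  have h1 : (𝓝 (1 : G)).HasBasis (fun U => U ∈ Set.range s) id := by
    refine ⟨fun t => (h.mem_iff).trans ?_⟩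
    simp
  have h2 : nbhdCharacter G ≤ #(Set.range s) := csInf_le' (a := #(Set.range s)) ⟨_, h1, rfl⟩
  exact h2.trans mk_range_le

/-- The intersection of a finite basis is a neighbourhood of the identity, equal to `{1}` by
separation. Then `{1}` alone is a basis, and the character is at most 1. -/
theorem aleph0_le_nbhdCharacter [IsTopologicalGroup G] [T2Space G] (h : 1 < nbhdCharacter G) :
    ℵ₀ ≤ nbhdCharacter G := by
  by_contra hlt
  rw [not_le] at hlt
  obtain ⟨B, hB, hcard⟩ := exists_basis_card_eq_nbhdCharacter G
  have hfin : B.Finite := by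
    rw [← Set.finite_coe_iff, ← Cardinal.lt_aleph0_iff_finite, hcard]
    exact hlt
  have hN : ⋂₀ B ∈ 𝓝 (1 : G) := (Filter.sInter_mem hfin).2 fun U hU => hB.mem_of_mem hU
  have hsub : ⋂₀ B ⊆ {1} := by
    intro x hx
    by_contra hx1
    have : {x}ᶜ ∈ 𝓝 (1 : G) := isOpen_compl_singleton.mem_nhds fun h => hx1 h.symm
    obtain ⟨U, hU, hUx⟩ := hB.mem_iff.1 this
    exact hUx (hx U hU) rfl
  have h1 : (𝓝 (1 : G)).HasBasis (fun _ : PUnit.{u + 1} => True) fun _ => {1} := by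
    refine ⟨fun t => ⟨fun ht => ⟨⟨⟩, trivial, ?_⟩, fun ⟨_, _, ht⟩ => ?_⟩⟩
    · simpa using mem_of_mem_nhds ht
    · exact Filter.mem_of_superset hN (hsub.trans ht)
  have := nbhdCharacter_le_of_hasBasis h1
  simp only [mk_punit] at this
  exact absurd h this.not_gt

/-- A compact subset of a topological group has at most `nbhdCharacter G` open sets sufficient to
separate its compact subsets from closed sets. -/
theorem exists_small_family_of_isCompact [IsTopologicalGroup G] [T2Space G]
    (h : ℵ₀ ≤ nbhdCharacter G) {K : Set G} (hK : IsCompact K) :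
    ∃ (J : Type u) (A : J → Set G), #J ≤ nbhdCharacter G ∧ (∀ j, IsOpen (A j)) ∧
      ∀ C O, IsCompact C → C ⊆ K → IsOpen O → C ⊆ O → ∃ j, C ⊆ A j ∧ A j ⊆ O := by
  classical
  obtain ⟨B, hB, hcard⟩ := exists_basis_card_eq_nbhdCharacter G
  have hcov : ∀ U : B, ∃ t : Finset G, K ⊆ ⋃ x ∈ t, (x * ·) '' interior (U : Set G) := by
    intro U
    refine hK.elim_finite_subcover (fun x : G => (x * ·) '' interior (U : Set G))
      (fun x => isOpenMap_mul_left x _ isOpen_interior) fun x _ => ?_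
    exact Set.mem_iUnion.2 ⟨x, 1, mem_interior_iff_mem_nhds.2 (hB.mem_of_mem U.2), mul_one x⟩
  choose t ht using hcov
  let I := Σ U : B, t U
  let W : I → Set G := fun i => ((i.2 : G) * ·) '' interior (i.1 : Set G)
  have hW : ∀ x ∈ K, ∀ O, IsOpen O → x ∈ O → ∃ i, x ∈ W i ∧ W i ⊆ O := by
    intro x hx O hO hxO
    have h1 : (x * ·) ⁻¹' O ∈ 𝓝 (1 : G) :=
      (hO.preimage (continuous_const_mul x)).mem_nhds (by simpa using hxO)
    -- If `x = y u` with `u` in a small `U`, the translate `y U` consists of the points `x (u⁻¹ v)`,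
    -- so `U⁻¹ U` must be small.
    have h2 : Filter.Tendsto (fun p : G × G => p.1⁻¹ * p.2) (𝓝 (1 : G) ×ˢ 𝓝 1) (𝓝 1) := by
      rw [← nhds_prod_eq]
      have : Continuous fun p : G × G => p.1⁻¹ * p.2 := by fun_prop
      simpa using this.tendsto (1, 1)
    obtain ⟨V, hV, hVV⟩ := Filter.mem_prod_same_iff.1 (h2 h1)
    obtain ⟨U, hU, hUV⟩ := hB.mem_iff.1 hV
    have hxU := ht ⟨U, hU⟩ hx
    simp only [Set.mem_iUnion] at hxU
    obtain ⟨y, hy, u, hu, hyu⟩ := hxU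
    refine ⟨⟨⟨U, hU⟩, ⟨y, hy⟩⟩, ⟨u, hu, hyu⟩, ?_⟩
    rintro _ ⟨v, hv, rfl⟩
    have h3 : x * (u⁻¹ * v) ∈ O :=
      hVV (show (u, v) ∈ V ×ˢ V from ⟨hUV (interior_subset hu), hUV (interior_subset hv)⟩)
    rw [← hyu] at h3
    simpa [mul_assoc] using h3
  have hI : #I ≤ nbhdCharacter G := by
    calc #I = Cardinal.sum fun U : B => #(t U) := Cardinal.mk_sigma _
      _ ≤ Cardinal.sum fun _ : B => ℵ₀ := Cardinal.sum_le_sum _ _ fun U =>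
          (Cardinal.lt_aleph0_of_finite _).le
      _ = nbhdCharacter G * ℵ₀ := by simp [hcard]
      _ = nbhdCharacter G := Cardinal.mul_eq_left h h Cardinal.aleph0_ne_zero
  refine ⟨Finset I, fun F => ⋃ i ∈ F, W i, ?_, fun F => ?_, ?_⟩
  · rcases finite_or_infinite I with hfin | hinf
    · exact (Cardinal.mk_le_aleph0).trans h
    · rw [Cardinal.mk_finset_of_infinite]; exact hI
  · exact isOpen_biUnion fun i _ => isOpenMap_mul_left _ _ isOpen_interior
  · intro C O hC hCK hO hCO
    obtain ⟨F, hF⟩ := hC.elim_finite_subcover (fun i : {i : I // W i ⊆ O} => W i)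
      (fun i => isOpenMap_mul_left _ _ isOpen_interior) (fun x hx => by
        obtain ⟨i, hi, hiO⟩ := hW x (hCK hx) O hO (hCO hx)
        exact Set.mem_iUnion.2 ⟨⟨i, hiO⟩, hi⟩)
    refine ⟨F.image Subtype.val, fun x hx => ?_, ?_⟩
    · obtain ⟨i, hi, hxi⟩ := Set.mem_iUnion₂.1 (hF hx)
      exact Set.mem_iUnion₂.2 ⟨i, Finset.mem_image_of_mem _ hi, hxi⟩
    · refine Set.iUnion₂_subset fun i hi => ?_
      obtain ⟨j, _, rfl⟩ := Finset.mem_image.1 hi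
      exact j.2

end Character

/-! ### The upper bound: compression to a compact neighbourhood -/

section Compress

variable {G : Type u} [Group G] [TopologicalSpace G] [IsTopologicalGroup G] [T2Space G]
  [MeasurableSpace G] [BorelSpace G] (ν : Measure G) [ν.IsHaarMeasure] [ν.Regular]

/-- The indicator function of `A ∩ K` in `L²(G)`, for `A` open and `K` compact. -/
def indVec {A K : Set G} (hA : IsOpen A) (hK : IsCompact K) : Lp ℂ 2 ν :=
  indicatorConstLp 2 (hA.measurableSet.inter hK.measurableSet)
    ((measure_mono Set.inter_subset_right).trans_lt hK.measure_lt_top).ne (1 : ℂ)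

/-- By outer regularity the indicator of a compact `C ⊆ K` is an `L²` limit of the given vectors, so
the integrals of `y` over compact subsets of `K` vanish. -/
theorem ae_eq_zero_of_inner_indVec_eq_zero {K : Set G} (hK : IsCompact K) {J : Type*}
    {A : J → Set G} (hA : ∀ j, IsOpen (A j))
    (hJ : ∀ C O, IsCompact C → C ⊆ K → IsOpen O → C ⊆ O → ∃ j, C ⊆ A j ∧ A j ⊆ O)
    {y : Lp ℂ 2 ν} (hy : ∀ j, inner ℂ (indVec ν (hA j) hK) y = 0) :
    ∀ᵐ s ∂ν, s ∈ K → y s = 0 := by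
  have hKm := hK.measurableSet
  have hfin {C : Set G} (hC : IsCompact C) : ν C ≠ ∞ := hC.measure_lt_top.ne
  have hC0 : ∀ C, IsCompact C → C ⊆ K → ∫ s in C, y s ∂ν = 0 := by
    intro C hC hCK
    have h (n : ℕ) : ∃ j, C ⊆ A j ∧ ν (A j \ C) ≤ ((n : ℝ≥0∞) + 1)⁻¹ := by
      obtain ⟨O, hCO, hO, -, hOC⟩ := hC.measurableSet.exists_isOpen_sdiff_lt (hfin hC)
        (ε := ((n : ℝ≥0∞) + 1)⁻¹) (by simp)
      obtain ⟨j, h1, h2⟩ := hJ C O hC hCK hO hCO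
      exact ⟨j, h1, (measure_mono (Set.sdiff_subset_sdiff_left h2)).trans hOC.le⟩
    choose j hj1 hj2 using h
    have hlim : Filter.Tendsto (fun n => indVec ν (hA (j n)) hK) Filter.atTop
        (𝓝 (indicatorConstLp 2 hC.measurableSet (hfin hC) (1 : ℂ))) := by
      refine tendsto_indicatorConstLp_set (by norm_num) ?_
      refine tendsto_of_tendsto_of_tendsto_of_le_of_le tendsto_const_nhds
        (h := fun n : ℕ => ((n : ℝ≥0∞) + 1)⁻¹) ?_ (fun _ => zero_le) (fun n => ?_)
      · have := (ENNReal.tendsto_inv_nat_nhds_zero).comp (Filter.tendsto_add_atTop_nat 1)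
        simpa [Function.comp_def] using this
      · refine (measure_mono ?_).trans (hj2 n)
        rintro s (⟨h1, h2⟩ | ⟨h1, h2⟩)
        · exact ⟨h1.1, h2⟩
        · exact absurd ⟨hj1 n h1, hCK h1⟩ h2
    rw [← L2.inner_indicatorConstLp_one hC.measurableSet (hfin hC) y]
    refine tendsto_nhds_unique (hlim.inner tendsto_const_nhds) ?_
    simp [hy]
  have hint : Integrable (K.indicator y) ν := by
    rw [integrable_indicator_iff hKm]
    have : IsFiniteMeasure (ν.restrict K) := ⟨by simpa using hK.measure_lt_top⟩
    exact ((Lp.memLp y).restrict K).integrable (by norm_num)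
  have h0 := ae_eq_zero_of_forall_setIntegral_isClosed_eq_zero hint fun s hs => by
    rw [setIntegral_indicator hKm]
    exact hC0 _ (hK.inter_left hs) Set.inter_subset_right
  filter_upwards [h0] with s hs hsK
  simpa [hsK] using hs

/-- The conditions on `a` and `b` place them in `L²(K)`, where the indicator vectors are total;
totality is used once in each argument. -/
theorem inner_map_eq_zero_of_inner_indVec {K : Set G} (hK : IsCompact K) {J : Type*}
    {A : J → Set G} (hA : ∀ j, IsOpen (A j))
    (hJ : ∀ C O, IsCompact C → C ⊆ K → IsOpen O → C ⊆ O → ∃ j, C ⊆ A j ∧ A j ⊆ O)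
    {T : Lp ℂ 2 ν →L[ℂ] Lp ℂ 2 ν}
    (hT : ∀ i j, inner ℂ (indVec ν (hA i) hK) (T (indVec ν (hA j) hK)) = 0) {a b : Lp ℂ 2 ν}
    (ha : ∀ g : Lp ℂ 2 ν, (∀ᵐ s ∂ν, s ∈ K → g s = 0) → inner ℂ g a = 0)
    (hb : ∀ g : Lp ℂ 2 ν, (∀ᵐ s ∂ν, s ∈ K → g s = 0) → inner ℂ g b = 0) :
    inner ℂ a (T b) = 0 := by
  have h1 (j : J) : inner ℂ a (T (indVec ν (hA j) hK)) = 0 := by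
    rw [inner_eq_zero_symm]
    exact ha _ (ae_eq_zero_of_inner_indVec_eq_zero ν hK hA hJ fun i => hT i j)
  rw [← ContinuousLinearMap.adjoint_inner_left]
  refine hb _ (ae_eq_zero_of_inner_indVec_eq_zero ν hK hA hJ fun j => ?_)
  rw [inner_eq_zero_symm, ContinuousLinearMap.adjoint_inner_left, h1]

variable [LocallyCompactSpace G]

theorem inner_twistCLM_eq_zero {f : Lp ℂ 2 ν} {K : Set G} (hf : SupportedIn ν f K)
    (h : Lp ℂ 2 ν) (i : hbIndex ν) {g : Lp ℂ 2 ν} (hg : ∀ᵐ s ∂ν, s ∈ K → g s = 0) :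
    inner ℂ g (twistCLM ν f h i) = 0 := by
  rw [twistCLM_apply, inner_coords, inner_tens_eq_integral]
  refine integral_eq_zero_of_ae ?_
  filter_upwards [hf, hg, coeFn_twist ν f h] with s h1 h2 h3
  by_cases hs : s ∈ K
  · simp [h2 hs]
  · simp [h3, h1 hs]

/-- When `f` is supported in `K`, all coordinates of its twists lie in `L²(K)`, so `slice ν f f`
sees only the compression of the operator to `L²(K)`. -/
theorem slice_eq_of_inner_indVec {f : Lp ℂ 2 ν} {K : Set G} (hK : IsCompact K)
    (hf : SupportedIn ν f K) {J : Type*} {A : J → Set G} (hA : ∀ j, IsOpen (A j))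
    (hJ : ∀ C O, IsCompact C → C ⊆ K → IsOpen O → C ⊆ O → ∃ j, C ⊆ A j ∧ A j ⊆ O)
    {T T' : Lp ℂ 2 ν →L[ℂ] Lp ℂ 2 ν}
    (hT : ∀ i j, inner ℂ (indVec ν (hA i) hK) (T (indVec ν (hA j) hK)) =
      inner ℂ (indVec ν (hA i) hK) (T' (indVec ν (hA j) hK))) :
    slice ν f f T = slice ν f f T' := by
  ext1 h
  refine ext_inner_left ℂ fun k => ?_
  rw [inner_slice, inner_slice, lp.inner_eq_tsum, lp.inner_eq_tsum]
  congr 1 with i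
  rw [amp_apply, amp_apply, ← sub_eq_zero, ← inner_sub_right]
  refine inner_map_eq_zero_of_inner_indVec ν hK hA hJ (T := T - T') (fun i j => ?_)
    (fun g hg => inner_twistCLM_eq_zero ν hf k i hg)
    (fun g hg => inner_twistCLM_eq_zero ν hf h i hg)
  rw [sub_apply, inner_sub_right, hT, sub_self]

/-- Testing against vector functionals determines the operator, and the product functional `w` is
determined by its values at the `λ(x)`. -/
theorem eq_slice_of_isFourierSMul {f : Lp ℂ 2 ν} {T S : VN ν}
    (h : IsFourierSMul ν (vecVN ν f f) T S) : (S : Lp ℂ 2 ν →L[ℂ] Lp ℂ 2 ν) = slice ν f f T := by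
  ext1 a
  refine ext_inner_left ℂ fun b => ?_
  have hv : vecVN ν a b ∈ fourierAlgebra ν := by
    rw [fourierAlgebra_eq]; exact isNormalFunctional_vecVN ν a b
  obtain ⟨w, hw, h1, h2⟩ := h _ hv
  rw [fourierAlgebra_eq] at hw
  have hw' : w = pairVN ν (twistCLM ν f a) (twistCLM ν f b) :=
    IsNormalFunctional.ext ν hw (isNormalFunctional_pairVN ν _ _) fun x => by
      rw [pairVN_twistCLM_lam]
      exact h1 x
  rw [inner_slice_eq_pairVN, ← hw', ← h2, vecVN_apply]

/-- The normalized indicator function of a set of finite positive measure. -/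
theorem exists_unit_supportedIn {W : Set G} (hW : MeasurableSet W) (h0 : ν W ≠ 0)
    (hfin : ν W ≠ ∞) : ∃ f : Lp ℂ 2 ν, ‖f‖ = 1 ∧ SupportedIn ν f W := by
  let f₀ : Lp ℂ 2 ν := indicatorConstLp 2 hW hfin (1 : ℂ)
  have hn : ‖f₀‖ ≠ 0 := by
    rw [norm_indicatorConstLp (by norm_num) (by norm_num)]
    have : 0 < ν.real W := ENNReal.toReal_pos h0 hfin
    simpa using this.ne'
  refine ⟨((‖f₀‖⁻¹ : ℝ) : ℂ) • f₀, ?_, ?_⟩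
  · rw [norm_smul]; simp [hn]
  · filter_upwards [Lp.coeFn_smul ((‖f₀‖⁻¹ : ℝ) : ℂ) f₀,
      indicatorConstLp_coeFn (p := 2) (hs := hW) (hμs := hfin) (c := (1 : ℂ))] with s h1 h2 hs
    rw [h1, Pi.smul_apply, h2]
    simp [hs]

theorem mk_TIM_le (h : ℵ₀ ≤ nbhdCharacter G) :
    #(TIM ν) ≤ 2 ^ (2 ^ nbhdCharacter G : Cardinal.{u}) := by
  obtain ⟨K, hK, hK1⟩ := exists_compact_mem_nhds (1 : G)
  obtain ⟨J, A, hcard, hA, hJ⟩ := exists_small_family_of_isCompact h hK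
  obtain ⟨f, hf1, hfK⟩ := exists_unit_supportedIn ν hK.measurableSet
    (Measure.measure_pos_of_mem_nhds ν hK1).ne' hK.measure_lt_top.ne
  let r : VN ν → J × J → ℂ := fun T p =>
    inner ℂ (indVec ν (hA p.1) hK) (T.1 (indVec ν (hA p.2) hK))
  have hu : vecVN ν f f ∈ normalStates ν := ⟨isMean_vecVN ν hf1, isNormalFunctional_vecVN ν f f⟩
  have hr : ∀ m ∈ TIM ν, ∀ T T' : VN ν, r T = r T' → m T = m T' := by
    intro m hm T T' hTT
    obtain ⟨S, hS, hmS⟩ := hm.2 _ hu T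
    obtain ⟨S', hS', hmS'⟩ := hm.2 _ hu T'
    have : S = S' := by
      refine Subtype.ext ?_
      rw [eq_slice_of_isFourierSMul ν hS, eq_slice_of_isFourierSMul ν hS']
      exact slice_eq_of_inner_indVec ν hK hfK hA hJ fun i j => congrFun hTT (i, j)
    rw [← hmS, ← hmS', this]
  -- By `hr` a mean factors through the matrix entries `r`, so it is recovered from its values on
  -- one chosen operator for each array of entries that occurs.
  let Ψ : TIM ν → Set.range r → ℂ := fun m y => m.1 y.2.choose
  have hΨ : Function.Injective Ψ := by
    intro m m' hmm
    refine Subtype.ext (ContinuousLinearMap.ext fun T => ?_)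
    have hy : r T ∈ Set.range r := ⟨T, rfl⟩
    have h1 := congrFun hmm ⟨r T, hy⟩
    rw [hr m m.2 T _ hy.choose_spec.symm, hr m' m'.2 T _ hy.choose_spec.symm]
    exact h1
  have h1 : #(Set.range r) ≤ 2 ^ nbhdCharacter G := by
    refine (mk_set_le _).trans ?_
    rw [mk_arrow, mk_complex, ← two_power_aleph0, lift_power, lift_two, lift_aleph0, ← power_mul,
      lift_uzero]
    refine power_le_power_left two_ne_zero ?_
    rw [← mul_def]
    exact (mul_le_mul' h (mul_le_mul' hcard hcard)).trans (by simp [h, mul_eq_self])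
  refine (mk_le_of_injective hΨ).trans ?_
  rw [mk_arrow, mk_complex, ← two_power_aleph0, lift_power, lift_two, lift_aleph0, ← power_mul,
    lift_uzero]
  refine power_le_power_left two_ne_zero ?_
  have h2 : ℵ₀ ≤ (2 : Cardinal.{u}) ^ nbhdCharacter G := h.trans (cantor _).le
  exact (mul_le_mul' h2 h1).trans (by rw [mul_eq_self h2])

end Compress

/-! ### Independent families and many ultrafilters -/

section IndependentFamily

open Classical in
/-- The members of the independent family of Fichtenholz, Kantorovich and Hausdorff. -/
def traceSet {J : Type*} (X : Set J) : Set (Finset J × Finset (Finset J)) :=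
  {p | p.1.filter (· ∈ X) ∈ p.2}

theorem exists_ultrafilter_traceSet {J : Type*} (ε : Set (Set J)) :
    ∃ q : Ultrafilter (Finset J × Finset (Finset J)), ∀ X, traceSet X ∈ q ↔ X ∈ ε := by
  classical
  let S : Set J → Set (Finset J × Finset (Finset J)) := fun X =>
    if X ∈ ε then traceSet X else (traceSet X)ᶜ
  obtain ⟨q, hq⟩ := Ultrafilter.exists_ultrafilter_of_finite_inter_nonempty (Set.range S) (by
    intro T hT
    rw [← Set.image_univ, Finset.subset_set_image_iff] at hT
    obtain ⟨𝒳, -, rfl⟩ := hT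
    have hsep (X Y : Set J) : ∃ F : Finset J, X ≠ Y → ∃ j ∈ F, ¬(j ∈ X ↔ j ∈ Y) := by
      by_cases h : X = Y
      · exact ⟨∅, fun h' => absurd h h'⟩
      · obtain ⟨j, hj⟩ := not_forall.1 (mt Set.ext h)
        exact ⟨{j}, fun _ => ⟨j, by simp, hj⟩⟩
    choose s hs using hsep
    let F : Finset J := 𝒳.biUnion fun X => 𝒳.biUnion fun Y => s X Y
    have hF : ∀ X ∈ 𝒳, ∀ Y ∈ 𝒳, F.filter (· ∈ X) = F.filter (· ∈ Y) → X = Y := by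
      intro X hX Y hY h
      by_contra hne
      obtain ⟨j, hj, hjXY⟩ := hs X Y hne
      have hjF : j ∈ F := Finset.mem_biUnion.2 ⟨X, hX, Finset.mem_biUnion.2 ⟨Y, hY, hj⟩⟩
      have := congrArg (j ∈ ·) h
      simp only [Finset.mem_filter, hjF, true_and, eq_iff_iff] at this
      exact hjXY this
    -- The finite set `F` distinguishes the members of `𝒳` by their traces. Listing exactly the
    -- traces of those in `ε` gives a point satisfying all the finitely many prescribed choices.
    refine ⟨(F, (𝒳.filter (· ∈ ε)).image fun X => F.filter (· ∈ X)), ?_⟩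
    intro t ht
    obtain ⟨X, hX, rfl⟩ := Finset.mem_image.1 (Finset.mem_coe.1 ht)
    by_cases hXε : X ∈ ε
    · simp only [S, if_pos hXε, traceSet, Set.mem_ofPred_eq]
      exact Finset.mem_image.2 ⟨X, Finset.mem_filter.2 ⟨hX, hXε⟩, rfl⟩
    · simp only [S, if_neg hXε, traceSet, Set.mem_compl_iff, Set.mem_ofPred_eq]
      intro hmem
      obtain ⟨Y, hY, hYX⟩ := Finset.mem_image.1 hmem
      obtain ⟨hY1, hY2⟩ := Finset.mem_filter.1 hY
      exact hXε (hF Y hY1 X hX hYX ▸ hY2))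
  refine ⟨q, fun X => ⟨fun h => ?_, fun h => ?_⟩⟩
  · by_contra hX
    have : S X ∈ q := hq ⟨X, rfl⟩
    simp only [S, if_neg hX] at this
    exact Ultrafilter.compl_mem_iff_notMem.1 this h
  · have : S X ∈ q := hq ⟨X, rfl⟩
    simpa only [S, if_pos h] using this

/-- There are many ultrafilters on a directed index set that converge along it. -/
theorem exists_ultrafilters_tendsto {Γ α : Type u} {l : Filter α} {B : Set (Set α)}
    (hB : l.HasBasis (fun U => U ∈ B) id) (hΓ : ℵ₀ ≤ #Γ) (hcard : #B = #Γ) :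
    ∃ (U : Γ → Set α) (P : Set (Set Γ) → Ultrafilter Γ), (∀ γ, U γ ∈ l) ∧
      (∀ ε, ∀ V ∈ l, ∀ᶠ γ in P ε, U γ ⊆ V) ∧ Function.Injective P := by
  have : Infinite Γ := infinite_iff.2 hΓ
  have hJ : #(B × (Finset Γ × Finset (Finset Γ))) = #Γ := by
    simp only [mk_prod, lift_id, mk_finset_of_infinite, hcard, mul_eq_self hΓ]
  obtain ⟨e⟩ := Cardinal.eq.1 hJ
  let L : Filter B := Filter.comap (Subtype.val : B → Set α) l.smallSets
  have hL : L.NeBot := by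
    refine Filter.comap_neBot fun t ht => ?_
    obtain ⟨V, hV, hVt⟩ := (Filter.hasBasis_smallSets l).mem_iff.1 ht
    obtain ⟨W, hW, hWV⟩ := hB.mem_iff.1 hV
    exact ⟨⟨W, hW⟩, hVt hWV⟩
  choose q hq using fun ε : Set (Set Γ) => exists_ultrafilter_traceSet ε
  -- The first coordinate runs through shrinking basis sets, and the second remembers `ε`. The
  -- product index set still has the cardinality of `Γ`.
  let p : Set (Set Γ) → Ultrafilter (B × (Finset Γ × Finset (Finset Γ))) := fun ε =>
    Ultrafilter.of (L ×ˢ (q ε : Filter _))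
  have hp (ε : Set (Set Γ)) :
      (p ε : Filter (B × (Finset Γ × Finset (Finset Γ)))) ≤
        L ×ˢ (q ε : Filter (Finset Γ × Finset (Finset Γ))) :=
    Ultrafilter.of_le _
  refine ⟨fun γ => (e.symm γ).1, fun ε => (p ε).map e, fun γ => hB.mem_of_mem (e.symm γ).1.2,
    fun ε V hV => ?_, fun ε ε' h => ?_⟩
  · have h1 : ∀ᶠ b : B in L, (b : Set α) ⊆ V :=
      Filter.preimage_mem_comap ((Filter.hasBasis_smallSets l).mem_of_mem hV)
    have h2 : ∀ᶠ x in (p ε : Filter (B × (Finset Γ × Finset (Finset Γ)))),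
        (x.1 : Set α) ⊆ V :=
      (hp ε) (Filter.tendsto_fst.eventually h1)
    rw [Ultrafilter.coe_map, Filter.eventually_map]
    simpa using h2
  · have hpp : p ε = p ε' := by
      have := congrArg (Ultrafilter.map e.symm) h
      simpa [Ultrafilter.map_map] using this
    have key (ε : Set (Set Γ)) (X : Set Γ) : Prod.snd ⁻¹' traceSet X ∈ p ε ↔ X ∈ ε := by
      rw [← hq ε X]
      have hle : (p ε).map Prod.snd = q ε := by
        refine Ultrafilter.coe_le_coe.1 ?_
        exact (Filter.map_mono (hp ε)).trans Filter.tendsto_snd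
      rw [← hle]
      rfl
    ext X
    rw [← key, hpp, key]

end IndependentFamily

/-! ### Weak operator limits along ultrafilters -/

section WeakLimit

variable {H : Type*} [NormedAddCommGroup H] [InnerProductSpace ℂ H] [CompleteSpace H]

/-- For fixed `h`, the functionals `k ↦ ⟨S a h, k⟩` converge along `p`, and the Riesz representation
of the limit is the value at `h`. The inner product is linear in its second slot, hence the final
conjugation. -/
theorem exists_weak_operator_lim {Λ : Type*} (p : Ultrafilter Λ) (S : Λ → H →L[ℂ] H)
    (hS : ∀ a, ‖S a‖ ≤ 1) : ∃ T : H →L[ℂ] H, ∀ h k,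
      Filter.Tendsto (fun a => inner ℂ k (S a h)) p (𝓝 (inner ℂ k (T h))) := by
  have hlim (h : H) : ∃ v : H, ∀ k,
      Filter.Tendsto (fun a => inner ℂ (S a h) k) p (𝓝 (inner ℂ v k)) := by
    obtain ⟨m, hm⟩ := exists_strongDual_ultrafilter_lim p
      (fun a => innerSL ℂ (S a h)) (C := ‖h‖) fun a k => by
        refine (norm_inner_le_norm _ _).trans ?_
        gcongr
        simpa using (S a).le_of_opNorm_le (hS a) h
    refine ⟨(InnerProductSpace.toDual ℂ H).symm m, fun k => ?_⟩
    rw [InnerProductSpace.toDual_symm_apply]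
    exact hm k
  choose T hT using hlim
  have hnorm (h : H) : ‖T h‖ ≤ 1 * ‖h‖ := by
    have h1 : ‖inner ℂ (T h) (T h)‖ ≤ 1 * ‖h‖ * ‖T h‖ := by
      refine le_of_tendsto (hT h (T h)).norm (.of_forall fun a => ?_)
      refine (norm_inner_le_norm _ _).trans ?_
      gcongr
      exact (S a).le_of_opNorm_le (hS a) h
    rw [inner_self_eq_norm_sq_to_K] at h1
    have h2 : ‖T h‖ * ‖T h‖ ≤ 1 * ‖h‖ * ‖T h‖ := by simpa [sq] using h1
    rcases (norm_nonneg (T h)).eq_or_lt with h0 | h0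
    · rw [← h0]; positivity
    · exact le_of_mul_le_mul_right h2 h0
  refine ⟨LinearMap.mkContinuous
    { toFun := T
      map_add' := fun g h => ext_inner_right ℂ fun k => tendsto_nhds_unique (hT (g + h) k) (by
        simpa [inner_add_left] using (hT g k).add (hT h k))
      map_smul' := fun c h => ext_inner_right ℂ fun k => tendsto_nhds_unique (hT (c • h) k) (by
        simpa [inner_smul_left, mul_comm] using (hT h k).const_mul (starRingEnd ℂ c)) } 1 hnorm, fun h k => ?_⟩
  have := (Complex.continuous_conj.tendsto _).comp (hT h k)
  simpa [Function.comp_def, inner_conj_symm] using this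

end WeakLimit

/-! ### The lower bound from almost orthogonal systems -/

section System

variable {G : Type u} [Group G] [TopologicalSpace G] [IsTopologicalGroup G]
  [MeasurableSpace G] [BorelSpace G] (ν : Measure G) [ν.IsHaarMeasure]

/-- A family of unit vectors supported in prescribed sets, together with positive operators of
`VN(G)` that almost fix them and whose finite sums are at most `1`. -/
def HasAlmostOrthogonalSystem {Γ : Type*} (U : Γ → Set G) : Prop :=
  ∃ (E : Γ → Lp ℂ 2 ν →L[ℂ] Lp ℂ 2 ν) (f : Γ → Lp ℂ 2 ν), (∀ γ, E γ ∈ VN ν) ∧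
    (∀ γ, 0 ≤ E γ) ∧ (∀ s : Finset Γ, ∑ γ ∈ s, E γ ≤ 1) ∧ (∀ γ, ‖f γ‖ = 1) ∧
    (∀ γ, SupportedIn ν (f γ) (U γ)) ∧ ∀ γ, 3 / 4 ≤ (inner ℂ (f γ) (E γ (f γ))).re

theorem HasAlmostOrthogonalSystem.comp_equiv {Γ Δ : Type*} {U : Γ → Set G} (e : Γ ≃ Δ)
    (h : HasAlmostOrthogonalSystem ν (U ∘ e.symm)) : HasAlmostOrthogonalSystem ν U := by
  obtain ⟨E, f, h1, h2, h3, h4, h5, h6⟩ := h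
  refine ⟨E ∘ e, f ∘ e, fun γ => h1 _, fun γ => h2 _, fun s => ?_, fun γ => h4 _, fun γ => ?_,
    fun γ => h6 _⟩
  · have := h3 (s.map e.toEmbedding)
    rwa [Finset.sum_map] at this
  · simpa using h5 (e γ)

theorem re_inner_le_of_le {H : Type*} [NormedAddCommGroup H] [InnerProductSpace ℂ H]
    {S T : H →L[ℂ] H} (h : S ≤ T) (f : H) : (inner ℂ f (S f)).re ≤ (inner ℂ f (T f)).re := by
  have h1 : 0 ≤ inner ℂ f ((T - S) f) :=
    (ContinuousLinearMap.le_def S T |>.1 h).inner_nonneg_right f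
  rw [sub_apply, inner_sub_right] at h1
  have := (Complex.le_def.1 h1).1
  simpa using this

/-- Any subset of an almost orthogonal system is separated from its complement by an operator. -/
theorem exists_mem_VN_separating {Γ : Type*} {E : Γ → Lp ℂ 2 ν →L[ℂ] Lp ℂ 2 ν}
    {f : Γ → Lp ℂ 2 ν} (hE : ∀ γ, E γ ∈ VN ν) (hpos : ∀ γ, 0 ≤ E γ)
    (hsum : ∀ s : Finset Γ, ∑ γ ∈ s, E γ ≤ 1) (hf1 : ∀ γ, ‖f γ‖ = 1)
    (hf : ∀ γ, 3 / 4 ≤ (inner ℂ (f γ) (E γ (f γ))).re) (A : Set Γ) :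
    ∃ T ∈ VN ν, (∀ γ ∈ A, 3 / 4 ≤ (inner ℂ (f γ) (T (f γ))).re) ∧
      ∀ γ ∉ A, (inner ℂ (f γ) (T (f γ))).re ≤ 1 / 4 := by
  classical
  let S : Finset Γ → Lp ℂ 2 ν →L[ℂ] Lp ℂ 2 ν := fun s => ∑ γ ∈ s.filter (· ∈ A), E γ
  have hS0 (s) : 0 ≤ S s := Finset.sum_nonneg fun γ _ => hpos γ
  have hSn (s) : ‖S s‖ ≤ 1 :=
    (CStarAlgebra.norm_le_one_iff_of_nonneg (S s) (hS0 s)).2 (hsum _)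
  have hSVN (s) : S s ∈ VN ν := sum_mem fun γ _ => hE γ
  obtain ⟨T, hT⟩ := exists_weak_operator_lim (Ultrafilter.of Filter.atTop) S hSn
  have hTre (g : Lp ℂ 2 ν) : Filter.Tendsto (fun s => (inner ℂ g (S s g)).re)
      (Ultrafilter.of (Filter.atTop : Filter (Finset Γ))) (𝓝 (inner ℂ g (T g)).re) :=
    (Complex.continuous_re.tendsto _).comp (hT g g)
  refine ⟨T, ?_, fun γ hγ => ?_, fun γ hγ => ?_⟩
  · rw [mem_VN_iff, Set.mem_centralizer_iff]
    intro A hA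
    ext1 h
    refine ext_inner_left ℂ fun k => ?_
    rw [mul_apply_eq_comp, mul_apply_eq_comp, ← ContinuousLinearMap.adjoint_inner_left]
    refine tendsto_nhds_unique (hT h _) ((hT (A h) k).congr fun s => ?_)
    have := (Set.mem_centralizer_iff.1 ((mem_VN_iff ν).1 (hSVN s))) A hA
    have := congrArg (fun B : Lp ℂ 2 ν →L[ℂ] Lp ℂ 2 ν => B h) this
    simp only [mul_apply_eq_comp] at this
    rw [← this, ContinuousLinearMap.adjoint_inner_left]
  · refine ge_of_tendsto (hTre (f γ)) ?_
    have h1 : ∀ᶠ s in (Filter.atTop : Filter (Finset Γ)), γ ∈ s :=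
      (Filter.eventually_ge_atTop {γ}).mono fun s hs => by simpa using hs
    filter_upwards [Ultrafilter.of_le Filter.atTop h1] with s hs
    refine (hf γ).trans (re_inner_le_of_le ?_ _)
    exact Finset.single_le_sum (fun γ _ => hpos γ) (Finset.mem_filter.2 ⟨hs, hγ⟩)
  · refine le_of_tendsto' (hTre (f γ)) fun s => ?_
    -- For `γ ∉ A` the operator `E γ` is not a summand of `S s`, so it leaves at most `1 - 3/4` of
    -- the mass of `f γ` to `S s`.
    have h1 : E γ + S s ≤ 1 := by
      have := hsum (insert γ (s.filter (· ∈ A)))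
      rwa [Finset.sum_insert (by simp [hγ])] at this
    have h2 := re_inner_le_of_le h1 (f γ)
    rw [add_apply, inner_add_right, Complex.add_re, one_apply_eq_self,
      inner_self_eq_norm_sq_to_K, hf1] at h2
    have h3 := hf γ
    norm_num at h2
    linarith

variable [LocallyCompactSpace G] [ν.Regular]

theorem le_mk_TIM {Γ : Type u} (h : ℵ₀ ≤ nbhdCharacter G) (hΓ : #Γ = nbhdCharacter G)
    (hsys : ∀ U : Γ → Set G, (∀ γ, U γ ∈ 𝓝 (1 : G)) → HasAlmostOrthogonalSystem ν U) :
    2 ^ (2 ^ nbhdCharacter G : Cardinal.{u}) ≤ #(TIM ν) := by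
  obtain ⟨B, hB, hBcard⟩ := exists_basis_card_eq_nbhdCharacter G
  obtain ⟨U, P, hU, hP, hPinj⟩ := exists_ultrafilters_tendsto (Γ := Γ) hB (hΓ ▸ h)
    (hBcard.trans hΓ.symm)
  obtain ⟨E, f, hE, hpos, hsum, hf1, hfU, hf⟩ := hsys U hU
  have hm (ε : Set (Set Γ)) := exists_mem_TIM_of_ultrafilter ν (p := P ε) hf1
    fun V hV => (hP ε V hV).mono fun γ hγ => (hfU γ).mono hγ
  choose m hm hlim using hm
  have hinj : Function.Injective fun ε => (⟨m ε, hm ε⟩ : TIM ν) := by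
    intro ε ε' heq
    have heq' : m ε = m ε' := congrArg Subtype.val heq
    by_contra hne
    -- A set in one ultrafilter but not the other has its complement in the other; an operator
    -- separating the two forces values at least `3/4` and at most `1/4`.
    have : ∃ A, A ∈ P ε ∧ A ∉ P ε' := by
      by_contra! hcon
      exact hne (hPinj (Ultrafilter.eq_of_le fun A hA => by
        by_contra hA'
        have := hcon _ (Ultrafilter.compl_mem_iff_notMem.2 hA')
        exact Ultrafilter.compl_mem_iff_notMem.1 this hA))
    obtain ⟨A, hA, hA'⟩ := this
    obtain ⟨T, hT, hT1, hT2⟩ := exists_mem_VN_separating ν hE hpos hsum hf1 hf A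
    have h1 : 3 / 4 ≤ (m ε ⟨T, hT⟩).re :=
      ge_of_tendsto ((Complex.continuous_re.tendsto _).comp (hlim ε ⟨T, hT⟩))
        (Filter.mem_of_superset hA fun γ hγ => hT1 γ hγ)
    have h2 : (m ε' ⟨T, hT⟩).re ≤ 1 / 4 :=
      le_of_tendsto ((Complex.continuous_re.tendsto _).comp (hlim ε' ⟨T, hT⟩))
        (Filter.mem_of_superset (Ultrafilter.compl_mem_iff_notMem.2 hA') fun γ hγ => hT2 γ hγ)
    rw [heq'] at h1
    linarith
  calc 2 ^ (2 ^ nbhdCharacter G : Cardinal.{u}) = #(Set (Set Γ)) := by simp [mk_set, hΓ]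
    _ ≤ #(TIM ν) := mk_le_of_injective hinj

end System

/-! ### Projections onto vectors fixed by a subgroup -/

section FixedVectors

variable {G : Type u} [Group G] [TopologicalSpace G] [IsTopologicalGroup G]
  [MeasurableSpace G] [BorelSpace G] (ν : Measure G) [ν.IsHaarMeasure]

/-- The vectors in `L²(G)` fixed by a subgroup under left translation. -/
def fixedSpace (N : Subgroup G) : Submodule ℂ (Lp ℂ 2 ν) where
  carrier := {h | ∀ n ∈ N, leftRegular ν n h = h}
  zero_mem' := fun n _ => map_zero _
  add_mem' := fun {a b} ha hb n hn => by rw [map_add, ha n hn, hb n hn]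
  smul_mem' := fun c a ha n hn => by rw [map_smul, ha n hn]

theorem mem_fixedSpace {N : Subgroup G} {h : Lp ℂ 2 ν} :
    h ∈ fixedSpace ν N ↔ ∀ n ∈ N, leftRegular ν n h = h := Iff.rfl

theorem isClosed_fixedSpace (N : Subgroup G) : IsClosed (fixedSpace ν N : Set (Lp ℂ 2 ν)) := by
  have : (fixedSpace ν N : Set (Lp ℂ 2 ν)) = ⋂ n ∈ N, {h | leftRegular ν n h = h} := by
    ext h
    simp [mem_fixedSpace]
  rw [this]
  exact isClosed_biInter fun n _ => isClosed_eq (leftRegular ν n).continuous continuous_id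

instance completeSpace_fixedSpace (N : Subgroup G) : CompleteSpace (fixedSpace ν N) :=
  (isClosed_fixedSpace ν N).completeSpace_coe

/-- The projection onto the vectors fixed by a subgroup. -/
def fixedProj (N : Subgroup G) : Lp ℂ 2 ν →L[ℂ] Lp ℂ 2 ν := (fixedSpace ν N).starProjection

theorem leftRegular_fixedProj {N : Subgroup G} {n : G} (hn : n ∈ N) (h : Lp ℂ 2 ν) :
    leftRegular ν n (fixedProj ν N h) = fixedProj ν N h :=
  (fixedSpace ν N).starProjection_apply_mem h n hn

theorem fixedProj_eq_self {N : Subgroup G} {h : Lp ℂ 2 ν} (hh : h ∈ fixedSpace ν N) :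
    fixedProj ν N h = h :=
  Submodule.starProjection_eq_self_iff.2 hh

/-- An operator commuting with `λ`, and likewise its adjoint, preserves the fixed vectors, so it
commutes with the projection onto them. -/
theorem fixedProj_mem_VN (N : Subgroup G) : fixedProj ν N ∈ VN ν := by
  rw [mem_VN_iff, Set.mem_centralizer_iff]
  intro A hA
  rw [Set.mem_centralizer_iff] at hA
  have h1 : ∀ x h, A (leftRegular ν x h) = leftRegular ν x (A h) := fun x h =>
    (DFunLike.congr_fun (hA _ ⟨x, rfl⟩) h).symm
  have h2 : ∀ x h, star A (leftRegular ν x h) = leftRegular ν x (star A h) := fun x h => by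
    have := congrArg star (hA _ ⟨x⁻¹, rfl⟩)
    rw [star_mul, star_mul, leftRegular_star, inv_inv] at this
    exact DFunLike.congr_fun this h
  refine ContinuousLinearMap.ext fun w => ?_
  refine (starProjection_commute_of_invariant (fixedSpace ν N) (fun v hv n hn => ?_)
    (fun v hv n hn => ?_) w).symm
  · rw [← h1, hv n hn]
  · rw [← h2, hv n hn]

theorem fixedProj_anti {N N' : Subgroup G} (h : N ≤ N') : fixedProj ν N' ≤ fixedProj ν N :=
  Submodule.starProjection_le_starProjection_iff.2 fun _ hf n hn => hf n (h hn)

theorem fixedProj_nonneg (N : Subgroup G) : 0 ≤ fixedProj ν N := by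
  have := (Submodule.starProjection_le_starProjection_iff (U := ⊥) (V := fixedSpace ν N)).2 bot_le
  rwa [Submodule.starProjection_bot] at this

theorem fixedProj_le_one (N : Subgroup G) : fixedProj ν N ≤ 1 := by
  have := (Submodule.starProjection_le_starProjection_iff (U := fixedSpace ν N) (V := ⊤)).2 le_top
  rwa [Submodule.starProjection_top] at this

theorem re_inner_fixedProj (N : Subgroup G) (f : Lp ℂ 2 ν) :
    (inner ℂ f (fixedProj ν N f)).re = ‖fixedProj ν N f‖ ^ 2 := by
  have h : inner ℂ f (fixedProj ν N f) = inner ℂ (fixedProj ν N f) (fixedProj ν N f) := by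
    rw [fixedProj, Submodule.inner_starProjection_left_eq_right,
      Submodule.starProjection_eq_self_iff.2 ((fixedSpace ν N).starProjection_apply_mem f)]
  rw [h, inner_self_eq_norm_sq_to_K]
  norm_cast

theorem inner_leftRegular_fixedProj {N : Subgroup G} {n : G} (hn : n ∈ N) (f : Lp ℂ 2 ν) :
    inner ℂ (leftRegular ν n f) (fixedProj ν N f) = ((‖fixedProj ν N f‖ ^ 2 : ℝ) : ℂ) := by
  rw [← leftRegular_fixedProj ν hn f, inner_leftRegular_leftRegular,
    leftRegular_fixedProj ν hn f]
  have h : inner ℂ f (fixedProj ν N f) = inner ℂ (fixedProj ν N f) (fixedProj ν N f) := by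
    rw [fixedProj, Submodule.inner_starProjection_left_eq_right,
      Submodule.starProjection_eq_self_iff.2 ((fixedSpace ν N).starProjection_apply_mem f)]
  rw [h, inner_self_eq_norm_sq_to_K]
  norm_cast

theorem inner_leftRegular_eq_zero {f : Lp ℂ 2 ν} {X : Set G} (hf : SupportedIn ν f X) {x y : G}
    (h : ∀ t, x⁻¹ * t ∈ X → y⁻¹ * t ∉ X) :
    inner ℂ (leftRegular ν x f) (leftRegular ν y f) = 0 := by
  rw [L2.inner_def]
  refine integral_eq_zero_of_ae ?_
  have hx := (measurePreserving_mul_left ν x⁻¹).quasiMeasurePreserving.ae hf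
  have hy := (measurePreserving_mul_left ν y⁻¹).quasiMeasurePreserving.ae hf
  filter_upwards [hx, hy, leftRegular_coeFn ν x f, leftRegular_coeFn ν y f] with t h1 h2 h3 h4
  rw [h3, h4]
  by_cases ht : x⁻¹ * t ∈ X
  · simp [h2 (h t ht)]
  · simp [h1 ht]

theorem exists_unit_supportedIn_fixed {X : Set G} (hX : MeasurableSet X) (h0 : ν X ≠ 0)
    (hfin : ν X ≠ ∞) : ∃ f : Lp ℂ 2 ν, ‖f‖ = 1 ∧ SupportedIn ν f X ∧
      ∀ n : G, (∀ t, n⁻¹ * t ∈ X ↔ t ∈ X) → leftRegular ν n f = f := by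
  let f₀ : Lp ℂ 2 ν := indicatorConstLp 2 hX hfin (1 : ℂ)
  have hn : ‖f₀‖ ≠ 0 := by
    rw [norm_indicatorConstLp (by norm_num) (by norm_num)]
    have : 0 < ν.real X := ENNReal.toReal_pos h0 hfin
    simpa using this.ne'
  have hf₀ : f₀ =ᵐ[ν] X.indicator fun _ => (1 : ℂ) := indicatorConstLp_coeFn
  refine ⟨((‖f₀‖⁻¹ : ℝ) : ℂ) • f₀, ?_, ?_, fun n hX' => ?_⟩
  · rw [norm_smul, Complex.norm_real, norm_inv, norm_norm, inv_mul_cancel₀ hn]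
  · change ∀ᵐ s ∂ν, _
    filter_upwards [hf₀, Lp.coeFn_smul ((‖f₀‖⁻¹ : ℝ) : ℂ) f₀] with s h1 h2 hs
    rw [h2, Pi.smul_apply, h1, Set.indicator_of_notMem hs, smul_zero]
  · rw [map_smul]
    congr 1
    apply Lp.ext
    filter_upwards [leftRegular_coeFn ν n f₀, hf₀,
      (measurePreserving_mul_left ν n⁻¹).quasiMeasurePreserving.ae hf₀] with t h1 h2 h3
    rw [h1, h2, h3]
    by_cases ht : t ∈ X
    · rw [Set.indicator_of_mem ht, Set.indicator_of_mem ((hX' t).2 ht)]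
    · rw [Set.indicator_of_notMem ht, Set.indicator_of_notMem (mt (hX' t).1 ht)]

/-- The four translates are orthonormal and each has inner product `c = ‖P f‖²` with `P f`. Bessel's
inequality reads `4 c² ≤ c`. -/
theorem norm_fixedProj_sq_le {N : Subgroup G} {f : Lp ℂ 2 ν} (hf : ‖f‖ = 1) {n : Fin 4 → G}
    (hn : ∀ i, n i ∈ N)
    (h : ∀ i j, i ≠ j → inner ℂ (leftRegular ν (n i) f) (leftRegular ν (n j) f) = 0) :
    ‖fixedProj ν N f‖ ^ 2 ≤ 1 / 4 := by
  have ho : Orthonormal ℂ fun i => leftRegular ν (n i) f :=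
    ⟨fun i => by rw [norm_leftRegular, hf], fun i j hij => h i j hij⟩
  have hB := ho.sum_inner_products_le (fixedProj ν N f) (s := Finset.univ)
  have h2 : ∀ i, ‖inner ℂ (leftRegular ν (n i) f) (fixedProj ν N f)‖ = ‖fixedProj ν N f‖ ^ 2 := by
    intro i
    rw [inner_leftRegular_fixedProj ν (hn i), Complex.norm_real, Real.norm_of_nonneg (by positivity)]
  simp only [h2, Finset.sum_const, Finset.card_univ, Fintype.card_fin] at hB
  generalize ‖fixedProj ν N f‖ ^ 2 = c at hB ⊢
  rw [nsmul_eq_mul] at hB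
  push_cast at hB
  nlinarith

/-- The sums of consecutive differences in an increasing chain of intervals of operators are
dominated by any upper bound of the chain. -/
theorem sum_sub_le_of_chain {V : Type*} [AddCommGroup V] [PartialOrder V] [IsOrderedAddMonoid V]
    {Γ : Type*} [LinearOrder Γ] {P Q : Γ → V} (hP : ∀ γ, 0 ≤ P γ)
    (hQP : ∀ γ δ, γ < δ → Q γ ≤ P δ) (s : Finset Γ) :
    ∀ R, 0 ≤ R → (∀ γ ∈ s, Q γ ≤ R) → ∑ γ ∈ s, (Q γ - P γ) ≤ R := by
  induction s using Finset.induction_on_max with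
  | empty => intro R hR _; simpa using hR
  | insert a s ha ih =>
    intro R hR h
    rw [Finset.sum_insert fun h' => (ha a h').false]
    -- All differences below the largest index `a` sum to at most `P a`, and adding `Q a - P a`
    -- telescopes to `Q a`.
    have h1 := ih (P a) (hP a) fun γ hγ => hQP γ a (ha γ hγ)
    calc Q a - P a + ∑ γ ∈ s, (Q γ - P γ) ≤ Q a - P a + P a := by gcongr
      _ = Q a := sub_add_cancel _ _
      _ ≤ R := h a (Finset.mem_insert_self _ _)

end FixedVectors

/-! ### Closed `G_δ` subgroups -/

section GDelta

variable {G : Type u} [Group G] [TopologicalSpace G] [IsTopologicalGroup G]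

/-- A subset that is the intersection of countably many closed neighbourhoods of the identity. -/
def IsClosedGDeltaNhd (H : Set G) : Prop :=
  ∃ V : ℕ → Set G, (∀ n, V n ∈ 𝓝 (1 : G) ∧ IsClosed (V n)) ∧ H = ⋂ n, V n

/-- Intersect a sequence of closed symmetric neighbourhoods with `V (n + 1) * V (n + 1) ⊆ V n`. The
sequence starts at `F U` rather than `U`, so that every term is closed and symmetric. -/
theorem exists_subgroup_isClosedGDeltaNhd {U : Set G} (hU : U ∈ 𝓝 (1 : G)) :
    ∃ H : Subgroup G, (H : Set G) ⊆ U ∧ IsClosedGDeltaNhd (H : Set G) := by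
  choose! F hF hFc hFinv hFmul using
    fun (W : Set G) (hW : W ∈ 𝓝 (1 : G)) => exists_closed_nhds_one_inv_eq_mul_subset hW
  let V : ℕ → Set G := fun n => F^[n] (F U)
  have hVs : ∀ n, V (n + 1) = F (V n) := fun n => Function.iterate_succ_apply' F n (F U)
  have hV : ∀ n, V n ∈ 𝓝 (1 : G) ∧ IsClosed (V n) ∧ (V n)⁻¹ = V n := by
    intro n
    induction n with
    | zero => exact ⟨hF U hU, hFc U hU, hFinv U hU⟩
    | succ n ih => rw [hVs]; exact ⟨hF _ ih.1, hFc _ ih.1, hFinv _ ih.1⟩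
  refine ⟨{ carrier := ⋂ n, V n, mul_mem' := ?_, one_mem' := ?_, inv_mem' := ?_ }, ?_,
    V, fun n => ⟨(hV n).1, (hV n).2.1⟩, rfl⟩
  · intro a b ha hb
    rw [Set.mem_iInter] at ha hb ⊢
    intro n
    refine hFmul _ (hV n).1 (Set.mul_mem_mul ?_ ?_)
    · rw [← hVs]; exact ha _
    · rw [← hVs]; exact hb _
  · exact Set.mem_iInter.2 fun n => mem_of_mem_nhds (hV n).1
  · intro a ha
    change a ∈ ⋂ n, V n at ha
    rw [Set.mem_iInter] at ha ⊢
    intro n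
    rw [← (hV n).2.2, Set.inv_mem_inv]
    exact ha n
  · intro a ha
    have ha0 : a ∈ F U := Set.mem_iInter.1 ha 0
    have := Set.mul_mem_mul ha0 (mem_of_mem_nhds (hF U hU))
    rw [mul_one] at this
    exact hFmul U hU this

/-- If the intersection were finite, some compact neighbourhood `C` would meet it only in the
identity. By compactness, finite intersections of the defining neighbourhoods with `C` would form a
basis, with fewer than `nbhdCharacter G` members. -/
theorem infinite_iInter_of_isClosedGDeltaNhd [LocallyCompactSpace G] [T2Space G]
    (h : ℵ₀ < nbhdCharacter G) {ι : Type u} (hι : #ι < nbhdCharacter G) {H : ι → Set G}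
    (hH : ∀ i, IsClosedGDeltaNhd (H i)) : (⋂ i, H i).Infinite := by
  choose V hV hHV using hH
  intro hfin
  have hnhd : ((⋂ i, H i) \ {1})ᶜ ∈ 𝓝 (1 : G) :=
    (hfin.sdiff).isClosed.isOpen_compl.mem_nhds (by simp)
  obtain ⟨C, hC, hCsub, hCc⟩ := local_compact_nhds hnhd
  have hCcl : IsClosed C := hCc.isClosed
  have hbasis : (𝓝 (1 : G)).HasBasis (fun _ : Finset (ι × ULift.{u} ℕ) => True)
      fun F => C ∩ ⋂ p ∈ F, V p.1 p.2.down := by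
    refine ⟨fun t => ⟨fun ht => ?_, ?_⟩⟩
    · have hK : IsCompact (C \ interior t) := hCc.diff isOpen_interior
      obtain ⟨F, hF⟩ := hK.elim_finite_subfamily_closed
        (fun p : ι × ULift.{u} ℕ => V p.1 p.2.down) (fun p => (hV _ _).2) (by
          rw [Set.eq_empty_iff_forall_notMem]
          rintro x ⟨⟨hxC, hxt⟩, hx⟩
          have hxH : x ∈ ⋂ i, H i := by
            rw [Set.mem_iInter]
            intro i
            rw [hHV i, Set.mem_iInter]
            exact fun n => Set.mem_iInter.1 hx (i, ⟨n⟩)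
          by_cases hx1 : x = 1
          · rw [hx1] at hxt
            exact hxt (mem_interior_iff_mem_nhds.2 ht)
          · exact hCsub hxC ⟨hxH, hx1⟩)
      refine ⟨F, trivial, fun x hx => ?_⟩
      by_contra hxt
      have : x ∈ (C \ interior t) ∩ ⋂ p ∈ F, V p.1 p.2.down :=
        ⟨⟨hx.1, fun h' => hxt (interior_subset h')⟩, hx.2⟩
      rw [hF] at this
      exact this
    · rintro ⟨F, -, hF⟩
      refine Filter.mem_of_superset (Filter.inter_mem hC ?_) hF
      exact (Filter.biInter_finset_mem F).2 fun p _ => (hV _ _).1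
  have h1 := nbhdCharacter_le_of_hasBasis hbasis
  have h2 : #(Finset (ι × ULift.{u} ℕ)) < nbhdCharacter G := by
    by_cases hinf : Infinite (ι × ULift.{u} ℕ)
    · rw [mk_finset_of_infinite, mk_prod]
      simp only [lift_id, mk_uLift, mk_nat, lift_aleph0]
      exact mul_lt_of_lt h.le hι h
    · rw [not_infinite_iff_finite] at hinf
      have : Finite (Finset (ι × ULift.{u} ℕ)) := inferInstance
      exact (lt_aleph0_of_finite _).trans h
  exact absurd h1 h2.not_ge

end GDelta

/-! ### Almost orthogonal systems for uncountable character -/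

section Uncountable

open scoped Pointwise

variable {G : Type u} [Group G] [TopologicalSpace G] [IsTopologicalGroup G]
  [MeasurableSpace G] [BorelSpace G] (ν : Measure G) [ν.IsHaarMeasure]
  [LocallyCompactSpace G] [T2Space G]

/-- The vector is a normalized indicator of a set invariant under `N ⊓ H` but so small that four
elements of `N` move it to disjoint sets. This is the one-step gap between the two fixed spaces. -/
theorem exists_subgroup_fixedProj {N : Subgroup G} (hN : (N : Set G).Infinite) {U : Set G}
    (hU : U ∈ 𝓝 (1 : G)) : ∃ H : Subgroup G, IsClosedGDeltaNhd (H : Set G) ∧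
      ∃ f : Lp ℂ 2 ν, ‖f‖ = 1 ∧ SupportedIn ν f U ∧ fixedProj ν (N ⊓ H) f = f ∧
        (inner ℂ f (fixedProj ν N f)).re ≤ 1 / 4 := by
  let n : Fin 4 → G := fun i => (hN.natEmbedding _ i : G)
  have hnN : ∀ i, n i ∈ N := fun i => (hN.natEmbedding _ i).2
  have hn : ∀ i j, i ≠ j → n i ≠ n j := fun i j hij h =>
    hij (Fin.ext ((hN.natEmbedding _).injective (Subtype.ext h)))
  obtain ⟨K, hKc, hK⟩ := exists_compact_mem_nhds (1 : G)
  have hW0 : U ∩ K ∩ {w | ∀ i j, i ≠ j → w ≠ (n i)⁻¹ * n j} ∈ 𝓝 (1 : G) := by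
    refine Filter.inter_mem (Filter.inter_mem hU hK) ?_
    change ∀ᶠ w in 𝓝 (1 : G), ∀ i j, i ≠ j → w ≠ (n i)⁻¹ * n j
    rw [Filter.eventually_all]
    intro i
    rw [Filter.eventually_all]
    intro j
    by_cases hij : i = j
    · exact .of_forall fun w h => absurd hij h
    · filter_upwards [isOpen_ne.mem_nhds
        (show (1 : G) ≠ (n i)⁻¹ * n j from fun h => hn i j hij (inv_mul_eq_one.1 h.symm))]
        with w hw _ using hw
  obtain ⟨V₁, hV₁, -, hV₁inv, hV₁mul⟩ := exists_closed_nhds_one_inv_eq_mul_subset hW0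
  obtain ⟨V₂, hV₂, -, -, hV₂mul⟩ := exists_closed_nhds_one_inv_eq_mul_subset hV₁
  obtain ⟨H, hHV, hH⟩ := exists_subgroup_isClosedGDeltaNhd hV₂
  refine ⟨H, hH, ?_⟩
  -- Left multiplication by `N ⊓ H` preserves `X`, and `X X⁻¹ ⊆ V₁ V₁` avoids each `(n i)⁻¹ * n j`
  -- with `i ≠ j`, so the translates by the `n i` are disjoint.
  let X : Set G := ((N ⊓ H : Subgroup G) : Set G) * interior V₂
  have hXo : IsOpen X := isOpen_interior.mul_left
  have hX1 : X ⊆ V₁ := (Set.mul_subset_mul (fun x hx => hHV hx.2) interior_subset).trans hV₂mul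
  have hX0 : X ⊆ U ∩ K := fun x hx => by
    have := Set.mul_mem_mul (hX1 hx) (mem_of_mem_nhds hV₁)
    rw [mul_one] at this
    exact (hV₁mul this).1
  have hXn : (1 : G) ∈ X :=
    ⟨1, one_mem _, 1, mem_interior_iff_mem_nhds.2 hV₂, mul_one 1⟩
  obtain ⟨f, hf1, hfX, hfix⟩ := exists_unit_supportedIn_fixed ν hXo.measurableSet
    (hXo.measure_pos ν ⟨1, hXn⟩).ne'
    ((measure_mono (hX0.trans Set.inter_subset_right)).trans_lt hKc.measure_lt_top).ne
  refine ⟨f, hf1, hfX.mono (hX0.trans Set.inter_subset_left), ?_, ?_⟩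
  · refine fixedProj_eq_self ν fun m hm => hfix m fun t => ⟨?_, ?_⟩
    · rintro ⟨a, ha, b, hb, hab⟩
      refine ⟨m * a, mul_mem hm ha, b, hb, ?_⟩
      change a * b = m⁻¹ * t at hab
      change m * a * b = t
      rw [mul_assoc, hab, mul_inv_cancel_left]
    · rintro ⟨a, ha, b, hb, rfl⟩
      exact ⟨m⁻¹ * a, mul_mem (inv_mem hm) ha, b, hb, mul_assoc _ _ _⟩
  · rw [re_inner_fixedProj]
    refine norm_fixedProj_sq_le ν hf1 hnN fun i j hij =>
      inner_leftRegular_eq_zero ν hfX fun t h1 h2 => ?_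
    have h3 : (n i)⁻¹ * n j ∈ V₁ * V₁ := by
      have h4 : ((n j)⁻¹ * t)⁻¹ ∈ V₁ := by
        rw [← hV₁inv, Set.inv_mem_inv]
        exact hX1 h2
      have := Set.mul_mem_mul (hX1 h1) h4
      simpa [mul_assoc] using this
    exact (hV₁mul h3).2 i j hij rfl

/-- A total form of the step, so that the recursion can choose a subgroup before the infinitude of
`N` is known; `⊤` is the default choice. -/
theorem exists_step_subgroup (N : Subgroup G) (U : Set G) :
    ∃ H : Subgroup G, IsClosedGDeltaNhd (H : Set G) ∧ ((N : Set G).Infinite → U ∈ 𝓝 (1 : G) →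
      ∃ f : Lp ℂ 2 ν, ‖f‖ = 1 ∧ SupportedIn ν f U ∧ fixedProj ν (N ⊓ H) f = f ∧
        (inner ℂ f (fixedProj ν N f)).re ≤ 1 / 4) := by
  by_cases h : (N : Set G).Infinite ∧ U ∈ 𝓝 (1 : G)
  · obtain ⟨H, hH, h2⟩ := exists_subgroup_fixedProj ν h.1 h.2
    exact ⟨H, hH, fun _ _ => h2⟩
  · exact ⟨⊤, ⟨fun _ => Set.univ, fun _ => ⟨Filter.univ_mem, isClosed_univ⟩, by simp⟩,
      fun h1 h2 => absurd ⟨h1, h2⟩ h⟩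

theorem hasAlmostOrthogonalSystem_of_aleph0_lt (h : ℵ₀ < nbhdCharacter G) {Γ : Type u}
    [LinearOrder Γ] [WellFoundedLT Γ] (hΓ : ∀ γ : Γ, #(Set.Iio γ) < nbhdCharacter G)
    (U : Γ → Set G) (hU : ∀ γ, U γ ∈ 𝓝 (1 : G)) : HasAlmostOrthogonalSystem ν U := by
  choose step hstep hstep' using exists_step_subgroup ν
  -- Transfinite recursion: `H γ` is chosen for the intersection `N γ` of all earlier subgroups,
  -- which is infinite as there are fewer than `nbhdCharacter G` of them.
  let H : Γ → Subgroup G := wellFounded_lt.fix fun γ rec =>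
    step (⨅ β : Set.Iio γ, rec β.1 β.2) (U γ)
  let N : Γ → Subgroup G := fun γ => ⨅ β : Set.Iio γ, H β
  have hHeq : ∀ γ, H γ = step (N γ) (U γ) := fun γ => wellFounded_lt.fix_eq _ γ
  have hHδ : ∀ γ, IsClosedGDeltaNhd (H γ : Set G) := fun γ => by
    rw [hHeq]; exact hstep _ _
  have hNinf : ∀ γ, (N γ : Set G).Infinite := fun γ => by
    have := infinite_iInter_of_isClosedGDeltaNhd h (hΓ γ) (H := fun β => (H β.1 : Set G))
      fun β => hHδ β
    rwa [← Subgroup.coe_iInf] at this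
  have hf : ∀ γ, ∃ f : Lp ℂ 2 ν, ‖f‖ = 1 ∧ SupportedIn ν f (U γ) ∧
      fixedProj ν (N γ ⊓ H γ) f = f ∧ (inner ℂ f (fixedProj ν (N γ) f)).re ≤ 1 / 4 := fun γ => by
    rw [hHeq]
    exact hstep' _ _ (hNinf γ) (hU γ)
  choose f hf1 hfU hfQ hfP using hf
  refine ⟨fun γ => fixedProj ν (N γ ⊓ H γ) - fixedProj ν (N γ), f, fun γ => ?_, fun γ => ?_,
    fun s => ?_, hf1, hfU, fun γ => ?_⟩
  · exact sub_mem (fixedProj_mem_VN ν _) (fixedProj_mem_VN ν _)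
  · exact sub_nonneg.2 (fixedProj_anti ν inf_le_left)
  · refine sum_sub_le_of_chain (fun γ => fixedProj_nonneg ν _) (fun γ δ hγδ => ?_) s 1 ?_
      fun γ _ => fixedProj_le_one ν _
    -- For `γ < δ` the subgroup `N δ` lies in `N γ ⊓ H γ`, so the intervals of projections are
    -- stacked in order.
    · refine fixedProj_anti ν (le_inf (le_iInf fun β => ?_) ?_)
      · exact iInf_le_of_le (⟨β.1, lt_trans β.2 hγδ⟩ : Set.Iio δ) le_rfl
      · exact iInf_le_of_le (⟨γ, hγδ⟩ : Set.Iio δ) le_rfl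
    · exact (fixedProj_nonneg ν ⊤).trans (fixedProj_le_one ν ⊤)
  · rw [sub_apply, inner_sub_right, hfQ, Complex.sub_re, inner_self_eq_norm_sq_to_K, hf1]
    have := hfP γ
    norm_num at this ⊢
    linarith

end Uncountable

/-! ### Spectral truncations of an injective positive operator -/

section ApproximateIdentity

variable {H : Type*} [NormedAddCommGroup H] [InnerProductSpace ℂ H] [CompleteSpace H]

theorem denseRange_of_injective_of_nonneg {a : H →L[ℂ] H} (ha : 0 ≤ a)
    (hinj : ∀ h, a h = 0 → h = 0) : DenseRange a := by
  have hsa : star a = a := (IsSelfAdjoint.of_nonneg ha).star_eq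
  have h1 : (LinearMap.range (a : H →ₗ[ℂ] H))ᗮ = ⊥ := by
    rw [Submodule.eq_bot_iff]
    intro h hh
    refine hinj h (ext_inner_left ℂ fun v => ?_)
    have := Submodule.inner_right_of_mem_orthogonal (LinearMap.mem_range_self (a : H →ₗ[ℂ] H) v) hh
    rw [inner_zero_right, ← this, ← hsa, ContinuousLinearMap.star_eq_adjoint,
      ContinuousLinearMap.adjoint_inner_right, ← ContinuousLinearMap.star_eq_adjoint, hsa]
    rfl
  have h2 := Submodule.topologicalClosure_eq_top_iff.2 h1
  intro h
  have : h ∈ ((LinearMap.range (a : H →ₗ[ℂ] H)).topologicalClosure : Set H) := by simp [h2]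
  rw [Submodule.topologicalClosure_coe] at this
  exact this

/-- Take `Q n = min(n a, 1)` by functional calculus. It is at most `n a`, hence small where `a` is
small. It tends strongly to 1 because `(1 - Q n) a` has norm at most `1/n` for `n ≥ 1` and the range
of `a` is dense. -/
theorem exists_monotone_approx {a : H →L[ℂ] H} (ha : 0 ≤ a) (hinj : ∀ h, a h = 0 → h = 0) :
    ∃ Q : ℕ → H →L[ℂ] H, Monotone Q ∧ (∀ n, 0 ≤ Q n) ∧ (∀ n, Q n ≤ 1) ∧
      (∀ n h, ‖h‖ = 1 → (inner ℂ h (Q n h)).re ≤ n * ‖a h‖) ∧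
      (∀ n A, Commute a A → Commute (Q n) A) ∧
      ∀ h, ‖h‖ = 1 → ∀ ε > 0, ∃ N, ∀ n ≥ N, 1 - ε ≤ (inner ℂ h (Q n h)).re := by
  have hsa : IsSelfAdjoint a := .of_nonneg ha
  have hspec : ∀ t ∈ spectrum ℝ a, 0 ≤ t := fun t ht => spectrum_nonneg_of_nonneg ha ht
  let g : ℕ → ℝ → ℝ := fun n t => min (n * t) 1
  have hg : ∀ n, Continuous (g n) := fun n => by fun_prop
  have hone : cfc (fun _ : ℝ => (1 : ℝ)) a = 1 := cfc_const_one ℝ a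
  have hsub : ∀ n, 1 - cfc (g n) a = cfc (fun t => 1 - g n t) a := fun n => by
    rw [cfc_sub (fun _ => 1) (g n) a continuousOn_const (hg n).continuousOn, hone]
  have hR : ∀ n, ‖1 - cfc (g n) a‖ ≤ 1 := fun n => by
    rw [hsub]
    refine norm_cfc_le zero_le_one fun t ht => ?_
    have h0 : 0 ≤ g n t := le_min (mul_nonneg n.cast_nonneg (hspec t ht)) zero_le_one
    have h1 : g n t ≤ 1 := min_le_right _ _
    rw [Real.norm_eq_abs, abs_le]
    constructor <;> linarith
  have hRa : ∀ n : ℕ, ‖(1 - cfc (g (n + 1)) a) * a‖ ≤ 1 / (n + 1) := fun n => by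
    have : (1 - cfc (g (n + 1)) a) * a = cfc (fun t => (1 - g (n + 1) t) * t) a := by
      rw [cfc_mul (fun t => 1 - g (n + 1) t) (fun t => t) a
        (continuous_const.sub (hg _)).continuousOn continuousOn_id, cfc_id' ℝ a, hsub]
    rw [this]
    refine norm_cfc_le (by positivity) fun t ht => ?_
    have h0 := hspec t ht
    have hn : (0 : ℝ) < n + 1 := by positivity
    simp only [g]
    push_cast
    rcases le_total ((n + 1 : ℝ) * t) 1 with h | h
    · rw [min_eq_left h, Real.norm_of_nonneg (mul_nonneg (by linarith) h0), le_div_iff₀ hn]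
      nlinarith
    · rw [min_eq_right h]
      simp
      positivity
  refine ⟨fun n => cfc (g n) a, fun m n hmn => ?_, fun n => ?_, fun n => ?_, fun n h hh => ?_,
    fun n A hA => hA.cfc_real _, fun h hh ε hε => ?_⟩
  · refine cfc_mono (fun t ht => ?_) (hg m).continuousOn (hg n).continuousOn
    exact min_le_min_right _ (mul_le_mul_of_nonneg_right (by exact_mod_cast hmn) (hspec t ht))
  · exact cfc_nonneg fun t ht => le_min (mul_nonneg n.cast_nonneg (hspec t ht)) zero_le_one
  · exact cfc_le_one _ _ fun t _ => min_le_right _ _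
  · have : (n : ℝ) • a = cfc (fun t => (n : ℝ) * t) a := by
      rw [cfc_const_mul_id (n : ℝ) a]
    have hle : cfc (g n) a ≤ (n : ℝ) • a := by
      rw [this]
      exact cfc_mono (fun t _ => min_le_left _ _) (hg n).continuousOn (by fun_prop)
    refine (re_inner_le_of_le hle h).trans
      ((Complex.re_le_norm _).trans ((norm_inner_le_norm _ _).trans ?_))
    rw [hh, one_mul, smul_apply, norm_smul, Real.norm_of_nonneg n.cast_nonneg]
  · obtain ⟨k, hk⟩ := (denseRange_of_injective_of_nonneg ha hinj).exists_dist_lt h (half_pos hε)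
    rw [dist_eq_norm] at hk
    obtain ⟨N, hN⟩ := exists_nat_gt (‖k‖ / (ε / 2))
    refine ⟨N + 1, fun n hn => ?_⟩
    obtain ⟨m, rfl⟩ : ∃ m, n = m + 1 := ⟨n - 1, by omega⟩
    have h1 : h - cfc (g (m + 1)) a h = (1 - cfc (g (m + 1)) a) (h - a k) +
        ((1 - cfc (g (m + 1)) a) * a) k := by
      rw [mul_apply_eq_comp, ← map_add, sub_add_cancel, sub_apply, one_apply_eq_self]
    have h5 := norm_add_le ((1 - cfc (g (m + 1)) a) (h - a k))
      (((1 - cfc (g (m + 1)) a) * a) k)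
    rw [← h1] at h5
    have h2 := ContinuousLinearMap.le_of_opNorm_le _ (hR (m + 1)) (h - a k)
    rw [one_mul] at h2
    have h3 := ContinuousLinearMap.le_of_opNorm_le _ (hRa m) k
    have h4 : 1 / ((m : ℝ) + 1) * ‖k‖ ≤ ε / 2 := by
      rw [div_mul_eq_mul_div, one_mul, div_le_iff₀ (by positivity)]
      rw [div_lt_iff₀ (half_pos hε)] at hN
      have : (N : ℝ) ≤ m := by exact_mod_cast (by omega : N ≤ m)
      nlinarith
    have h6 : (inner ℂ h (h - cfc (g (m + 1)) a h)).re ≤ ε := by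
      refine (Complex.re_le_norm _).trans ((norm_inner_le_norm _ _).trans ?_)
      rw [hh, one_mul]
      linarith
    rw [inner_sub_right, Complex.sub_re, inner_self_eq_norm_sq_to_K, hh] at h6
    norm_num at h6 ⊢
    linarith

theorem le_re_inner_sub {P Q : H →L[ℂ] H} {f : H} {p q r : ℝ} (hP : (inner ℂ f (P f)).re ≤ p)
    (hQ : q ≤ (inner ℂ f (Q f)).re) (h : p + r ≤ q) : r ≤ (inner ℂ f ((Q - P) f)).re := by
  rw [sub_apply, inner_sub_right, Complex.sub_re]
  linarith

theorem hasSum_apply_of_hasSum {T : ℕ → H →L[ℂ] H} {a : H →L[ℂ] H} (h : HasSum T a) (f : H) :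
    HasSum (fun n => T n f) (a f) :=
  (ContinuousLinearMap.apply ℂ H f).hasSum h

theorem exists_hasSum_star_mul_self (B : ℕ → H →L[ℂ] H) :
    ∃ (c : ℕ → ℂ) (a : H →L[ℂ] H), HasSum (fun n => c n • (star (B n) * B n)) a ∧ 0 ≤ a ∧
      ∀ f, a f = 0 → ∀ n, B n f = 0 := by
  -- Positive weights that make the series norm summable; positivity forces every `B n` to vanish on
  -- the kernel of the sum.
  let c : ℕ → ℝ := fun n => (1 / 2) ^ n / (1 + ‖star (B n) * B n‖)
  have hc : ∀ n, 0 < c n := fun n => by positivity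
  let T : ℕ → H →L[ℂ] H := fun n => (c n : ℂ) • (star (B n) * B n)
  have hTinner : ∀ n f, inner ℂ f (T n f) = ((c n * ‖B n f‖ ^ 2 : ℝ) : ℂ) := fun n f => by
    have : inner ℂ f (star (B n) (B n f)) = inner ℂ (B n f) (B n f) := by
      rw [ContinuousLinearMap.star_eq_adjoint, ContinuousLinearMap.adjoint_inner_right]
    simp only [T]
    rw [smul_apply, inner_smul_right, mul_apply_eq_comp, this, inner_self_eq_norm_sq_to_K]
    push_cast
    rfl
  have hTsum : Summable T := by
    refine Summable.of_norm_bounded summable_geometric_two fun n => ?_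
    simp only [T]
    rw [norm_smul, Complex.norm_real, Real.norm_of_nonneg (hc n).le]
    simp only [c]
    rw [div_mul_eq_mul_div, div_le_iff₀ (by positivity)]
    gcongr
    linarith
  refine ⟨fun n => c n, ∑' n, T n, hTsum.hasSum, tsum_nonneg fun n => ?_, fun f hf => ?_⟩
  · exact smul_nonneg (by exact_mod_cast (hc n).le) (star_mul_self_nonneg (B n))
  · have hin : HasSum (fun n => inner ℂ f (T n f)) (inner ℂ f ((∑' n, T n) f)) :=
      (innerSL ℂ f).hasSum (hasSum_apply_of_hasSum hTsum.hasSum f)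
    have h0 : HasSum (fun n => c n * ‖B n f‖ ^ 2) 0 := by
      have := Complex.hasSum_re hin
      simpa only [hTinner, Complex.ofReal_re, hf, inner_zero_right, Complex.zero_re] using this
    intro n
    have h2 := (hasSum_zero_iff_of_nonneg fun n => mul_nonneg (hc n).le (sq_nonneg _)).1 h0
    have h3 := congrFun h2 n
    simpa [(hc n).ne'] using h3

end ApproximateIdentity

/-! ### Almost orthogonal systems for countable character -/

section Averaging

variable {G : Type u} [Group G] [TopologicalSpace G] [IsTopologicalGroup G]
  [MeasurableSpace G] [BorelSpace G] (ν : Measure G) [ν.IsHaarMeasure]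
  [LocallyCompactSpace G] [T2Space G] [ν.Regular]

theorem integrableOn_leftRegular {K : Set G} (hK : IsCompact K) (f : Lp ℂ 2 ν) :
    IntegrableOn (fun x => leftRegular ν x f) K ν :=
  (continuous_leftRegular ν f).continuousOn.integrableOn_compact hK

/-- The convolution operator `∫_K λ(x) dx` for a compact set `K`. -/
def convOp {K : Set G} (hK : IsCompact K) : Lp ℂ 2 ν →L[ℂ] Lp ℂ 2 ν :=
  LinearMap.mkContinuous
    { toFun := fun f => ∫ x in K, leftRegular ν x f ∂ν
      map_add' := fun f g => by
        simp only [map_add]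
        exact integral_add (integrableOn_leftRegular ν hK f) (integrableOn_leftRegular ν hK g)
      map_smul' := fun c f => by
        simp only [map_smul]
        exact integral_smul c _ } (ν.real K) fun f => by
    rw [mul_comm]
    exact norm_setIntegral_le_of_norm_le_const hK.measure_lt_top
      fun x _ => (norm_leftRegular ν x f).le

theorem convOp_apply {K : Set G} (hK : IsCompact K) (f : Lp ℂ 2 ν) :
    convOp ν hK f = ∫ x in K, leftRegular ν x f ∂ν := rfl

theorem convOp_mem_VN {K : Set G} (hK : IsCompact K) : convOp ν hK ∈ VN ν := by
  rw [mem_VN_iff, Set.mem_centralizer_iff]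
  intro A hA
  rw [Set.mem_centralizer_iff] at hA
  refine ContinuousLinearMap.ext fun f => ?_
  rw [mul_apply_eq_comp, mul_apply_eq_comp, convOp_apply, convOp_apply,
    ← ContinuousLinearMap.integral_comp_comm A (integrableOn_leftRegular ν hK f)]
  congr 1
  funext x
  exact (DFunLike.congr_fun (hA _ ⟨x, rfl⟩) f).symm

/-- If the integral of `λ(x) f` over `K` vanishes, the average of `λ(x) f - f` over `K` is `-f`. -/
theorem norm_le_of_convOp_eq_zero {K : Set G} (hK : IsCompact K) (hK1 : K ∈ 𝓝 (1 : G))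
    {f : Lp ℂ 2 ν} (h : convOp ν hK f = 0) {ε : ℝ} (hε : ∀ x ∈ K, ‖leftRegular ν x f - f‖ ≤ ε) :
    ‖f‖ ≤ ε := by
  have hpos : 0 < ν.real K :=
    ENNReal.toReal_pos (Measure.measure_pos_of_mem_nhds ν hK1).ne' hK.measure_lt_top.ne
  have h1 : ∫ x in K, (leftRegular ν x f - f) ∂ν = -(ν.real K • f) := by
    have hc : IntegrableOn (fun _ => f) K ν := integrableOn_const hK.measure_lt_top.ne
    rw [integral_sub (integrableOn_leftRegular ν hK f) hc, ← convOp_apply ν hK, h, setIntegral_const,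
      zero_sub]
  have h2 := norm_setIntegral_le_of_norm_le_const (μ := ν) hK.measure_lt_top hε
  rw [h1, norm_neg, norm_smul, Real.norm_of_nonneg hpos.le, mul_comm] at h2
  exact le_of_mul_le_mul_right h2 hpos

/-- The operators that are small on unit vectors supported near the identity. -/
def vanishingOps : Submodule ℂ (Lp ℂ 2 ν →L[ℂ] Lp ℂ 2 ν) where
  carrier := {A | ∀ ε > 0, ∃ W ∈ 𝓝 (1 : G), ∀ f, ‖f‖ = 1 → SupportedIn ν f W → ‖A f‖ ≤ ε}
  zero_mem' := fun ε hε => ⟨Set.univ, Filter.univ_mem, fun f _ _ => by simpa using hε.le⟩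
  add_mem' := fun {A B} hA hB ε hε => by
    obtain ⟨W, hW, h1⟩ := hA (ε / 2) (half_pos hε)
    obtain ⟨W', hW', h2⟩ := hB (ε / 2) (half_pos hε)
    refine ⟨W ∩ W', Filter.inter_mem hW hW', fun f hf hfW => ?_⟩
    have := h1 f hf (hfW.mono Set.inter_subset_left)
    have := h2 f hf (hfW.mono Set.inter_subset_right)
    have := norm_add_le (A f) (B f)
    rw [add_apply]
    linarith
  smul_mem' := fun c A hA ε hε => by
    obtain ⟨W, hW, h1⟩ := hA (ε / (‖c‖ + 1)) (by positivity)
    refine ⟨W, hW, fun f hf hfW => ?_⟩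
    rw [smul_apply, norm_smul]
    have h2 := h1 f hf hfW
    rw [le_div_iff₀ (by positivity)] at h2
    nlinarith [norm_nonneg (A f), norm_nonneg c]

theorem isClosed_vanishingOps :
    IsClosed (vanishingOps ν : Set (Lp ℂ 2 ν →L[ℂ] Lp ℂ 2 ν)) := by
  refine isClosed_of_closure_subset fun A hA ε hε => ?_
  obtain ⟨B, hB, hAB⟩ := Metric.mem_closure_iff.1 hA (ε / 2) (half_pos hε)
  obtain ⟨W, hW, h1⟩ := hB (ε / 2) (half_pos hε)
  refine ⟨W, hW, fun f hf hfW => ?_⟩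
  have h2 := h1 f hf hfW
  rw [dist_eq_norm] at hAB
  have h3 := (A - B).le_of_opNorm_le hAB.le f
  rw [hf, mul_one, sub_apply] at h3
  have h4 := norm_add_le (A f - B f) (B f)
  rw [sub_add_cancel] at h4
  linarith

theorem mul_mem_vanishingOps (B : Lp ℂ 2 ν →L[ℂ] Lp ℂ 2 ν) {A : Lp ℂ 2 ν →L[ℂ] Lp ℂ 2 ν}
    (hA : A ∈ vanishingOps ν) : B * A ∈ vanishingOps ν := by
  intro ε hε
  obtain ⟨W, hW, h1⟩ := hA (ε / (‖B‖ + 1)) (by positivity)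
  refine ⟨W, hW, fun f hf hfW => ?_⟩
  have h2 := h1 f hf hfW
  rw [le_div_iff₀ (by positivity)] at h2
  have h3 := B.le_opNorm (A f)
  rw [mul_apply_eq_comp]
  nlinarith [norm_nonneg (A f), norm_nonneg B]

/-- For `f` supported in `W` with `W W⁻¹ ⊆ V`, the inner product of `λ(x) f` and `λ(y) f` vanishes
unless `x⁻¹ y ∈ V`. Hence the squared norm of the image of `f` is at most `ν(V) ν(K)`, and `ν(V)`
can be made small since the identity is a null set. -/
theorem convOp_mem_vanishingOps (h1 : ν {1} = 0) {K : Set G} (hK : IsCompact K) :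
    convOp ν hK ∈ vanishingOps ν := by
  intro ε hε
  have hδ : 0 < ε ^ 2 / (ν.real K + 1) := by positivity
  obtain ⟨V, hV1, hVo, hV⟩ := Set.exists_isOpen_lt_of_lt ({1} : Set G)
    (ENNReal.ofReal (ε ^ 2 / (ν.real K + 1))) (by rw [h1]; exact ENNReal.ofReal_pos.2 hδ)
  have hVreal : ν.real V ≤ ε ^ 2 / (ν.real K + 1) :=
    ENNReal.toReal_le_of_le_ofReal hδ.le hV.le
  obtain ⟨W, hW, -, hWinv, hWmul⟩ :=
    exists_closed_nhds_one_inv_eq_mul_subset (hVo.mem_nhds (hV1 rfl))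
  refine ⟨W, hW, fun f hf hfW => ?_⟩
  have hin : ∀ x, ‖inner ℂ (leftRegular ν x f) (convOp ν hK f)‖ ≤ ν.real V := by
    intro x
    rw [convOp_apply, ← integral_inner (integrableOn_leftRegular ν hK f)]
    have hmp := measurePreserving_mul_left ν x⁻¹
    have hmeas : MeasurableSet ((fun t => x⁻¹ * t) ⁻¹' V) :=
      hmp.measurable hVo.measurableSet
    have hfin : ν ((fun t => x⁻¹ * t) ⁻¹' V) = ν V :=
      hmp.measure_preimage hVo.measurableSet.nullMeasurableSet
    have hreal : ν.real ((fun t => x⁻¹ * t) ⁻¹' V) = ν.real V := by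
      rw [measureReal_def, hfin, measureReal_def]
    calc ‖∫ y in K, inner ℂ (leftRegular ν x f) (leftRegular ν y f) ∂ν‖
        ≤ ∫ y in K, ((fun t => x⁻¹ * t) ⁻¹' V).indicator (fun _ => (1 : ℝ)) y ∂ν := by
          refine norm_integral_le_of_norm_le ?_ (.of_forall fun y => ?_)
          · exact ((integrable_indicator_iff hmeas).2
              (integrableOn_const (by rw [hfin]; exact (hV.trans ENNReal.ofReal_lt_top).ne))).integrableOn
          · by_cases hy : x⁻¹ * y ∈ V
            · rw [Set.indicator_of_mem (show y ∈ (fun t => x⁻¹ * t) ⁻¹' V from hy)]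
              refine (norm_inner_le_norm _ _).trans ?_
              rw [norm_leftRegular, norm_leftRegular, hf, one_mul]
            · rw [Set.indicator_of_notMem (show y ∉ (fun t => x⁻¹ * t) ⁻¹' V from hy),
                inner_leftRegular_eq_zero ν hfW fun t ht1 ht2 => hy ?_, norm_zero]
              have h4 : (y⁻¹ * t)⁻¹ ∈ W := by
                rw [← hWinv, Set.inv_mem_inv]
                exact ht2
              have := hWmul (Set.mul_mem_mul ht1 h4)
              simpa [mul_assoc] using this
      _ ≤ ∫ y, ((fun t => x⁻¹ * t) ⁻¹' V).indicator (fun _ => (1 : ℝ)) y ∂ν := by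
          refine setIntegral_le_integral ((integrable_indicator_iff hmeas).2
              (integrableOn_const (by rw [hfin]; exact (hV.trans ENNReal.ofReal_lt_top).ne)))
              (.of_forall fun y => Set.indicator_nonneg (fun _ _ => zero_le_one) y)
      _ = ν.real V := by
          rw [integral_indicator hmeas, setIntegral_const, hreal, smul_eq_mul, mul_one]
  have hsq : ‖convOp ν hK f‖ ^ 2 ≤ ν.real V * ν.real K := by
    have h2 : inner ℂ (convOp ν hK f) (convOp ν hK f) =
        ∫ x in K, inner ℂ (convOp ν hK f) (leftRegular ν x f) ∂ν := by
      rw [integral_inner (integrableOn_leftRegular ν hK f), ← convOp_apply]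
    have h3 : ‖(inner ℂ (convOp ν hK f) (convOp ν hK f) : ℂ)‖ = ‖convOp ν hK f‖ ^ 2 := by
      rw [inner_self_eq_norm_sq_to_K]
      simp
    rw [← h3, h2]
    refine norm_setIntegral_le_of_norm_le_const hK.measure_lt_top fun x _ => ?_
    rw [norm_inner_symm]
    exact hin x
  refine le_of_sq_le_sq ?_ hε.le
  refine hsq.trans ?_
  rw [le_div_iff₀ (by positivity)] at hVreal
  nlinarith [measureReal_nonneg (μ := ν) (s := V)]

/-- Sum weighted `B* B` over the convolution operators of a compact basis. A vector killed by all of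
them is within every `ε` of zero, since translations act continuously and the basis shrinks to the
identity. -/
theorem exists_nonneg_injective_vanishing (h1 : ν {1} = 0) {K : ℕ → Set G}
    (hK : ∀ n, IsCompact (K n)) (hbasis : (𝓝 (1 : G)).HasBasis (fun _ : ℕ => True) K) :
    ∃ a ∈ VN ν, 0 ≤ a ∧ (∀ f, a f = 0 → f = 0) ∧ a ∈ vanishingOps ν := by
  obtain ⟨c, a, hsum, ha0, hinj⟩ := exists_hasSum_star_mul_self fun n => convOp ν (hK n)
  refine ⟨a, ?_, ha0, fun f hf => ?_, ?_⟩
  · refine (isClosed_VN ν).mem_of_tendsto hsum (.of_forall fun s => sum_mem fun n _ => ?_)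
    exact (VN ν).smul_mem (mul_mem (star_mem (convOp_mem_VN ν (hK n))) (convOp_mem_VN ν (hK n))) _
  · have hB := hinj f hf
    rw [← norm_le_zero_iff]
    refine le_of_forall_pos_le_add fun ε hε => ?_
    rw [zero_add]
    have hcont : Filter.Tendsto (fun x => leftRegular ν x f - f) (𝓝 1) (𝓝 0) := by
      have := ((continuous_leftRegular ν f).sub continuous_const).tendsto (f := fun x =>
        leftRegular ν x f - f) 1
      rwa [leftRegular_one, one_apply_eq_self, sub_self] at this
    have hev : ∀ᶠ x in 𝓝 (1 : G), ‖leftRegular ν x f - f‖ ≤ ε := by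
      filter_upwards [hcont.norm.eventually_lt_const (by simpa using hε)] with x hx using hx.le
    obtain ⟨n, -, hn⟩ := hbasis.mem_iff.1 hev
    exact norm_le_of_convOp_eq_zero ν (hK n) (hbasis.mem_of_mem trivial) (hB n)
      fun x hx => hn hx
  · refine (isClosed_vanishingOps ν).mem_of_tendsto hsum
      (.of_forall fun s => sum_mem fun n _ => ?_)
    exact (vanishingOps ν).smul_mem _ (mul_mem_vanishingOps ν _ (convOp_mem_vanishingOps ν h1 _))

theorem exists_compact_basis_of_nbhdCharacter_eq_aleph0 (h : nbhdCharacter G = ℵ₀) :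
    ∃ K : ℕ → Set G, (∀ n, IsCompact (K n)) ∧ (𝓝 (1 : G)).HasBasis (fun _ : ℕ => True) K := by
  obtain ⟨B, hB, hBc⟩ := exists_basis_card_eq_nbhdCharacter G
  have hBc' : #B = ℵ₀ := hBc.trans h
  have : Countable B := mk_le_aleph0_iff.1 hBc'.le
  have hBne : Nonempty B := mk_ne_zero_iff.1 (by rw [hBc']; exact aleph0_ne_zero)
  have hcg : (𝓝 (1 : G)).IsCountablyGenerated :=
    Filter.HasCountableBasis.isCountablyGenerated ⟨hB, Set.to_countable B⟩
  obtain ⟨K, hK, hKb⟩ := (compact_basis_nhds (1 : G)).exists_antitone_subbasis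
  exact ⟨K, fun n => (hK n).2, hKb.toHasBasis⟩

theorem measure_singleton_one_eq_zero (h : 1 < nbhdCharacter G) : ν {1} = 0 := by
  by_cases hne : (𝓝[≠] (1 : G)).NeBot
  · exact measure_singleton 1
  · rw [Filter.not_neBot] at hne
    have h1 : ({1} : Set G) ∈ 𝓝 (1 : G) := by
      rw [← isOpen_singleton_iff_punctured_nhds] at hne
      exact hne.mem_nhds rfl
    have h2 := nbhdCharacter_le_of_hasBasis (G := G) (ι := PUnit) (s := fun _ => {1})
      ⟨fun t => ⟨fun ht => ⟨⟨⟩, trivial, by simpa using mem_of_mem_nhds ht⟩,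
        fun ⟨_, _, h3⟩ => Filter.mem_of_superset h1 h3⟩⟩
    rw [mk_punit] at h2
    exact absurd h h2.not_gt

theorem hasAlmostOrthogonalSystem_nat (h : nbhdCharacter G = ℵ₀)
    (U : ℕ → Set G) (hU : ∀ n, U n ∈ 𝓝 (1 : G)) : HasAlmostOrthogonalSystem ν U := by
  obtain ⟨K, hK, hKb⟩ := exists_compact_basis_of_nbhdCharacter_eq_aleph0 h
  obtain ⟨a, haVN, ha0, hainj, hav⟩ := exists_nonneg_injective_vanishing ν
    (measure_singleton_one_eq_zero ν (h ▸ one_lt_aleph0)) hK hKb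
  obtain ⟨Q, hQmono, hQ0, hQ1, hQa, hQcomm, hQlim⟩ := exists_monotone_approx ha0 hainj
  have hQVN : ∀ n, Q n ∈ VN ν := fun n => by
    rw [mem_VN_iff, Set.mem_centralizer_iff] at haVN ⊢
    intro A hA
    exact (hQcomm n A (haVN A hA).symm).eq.symm
  have hstep : ∀ n N, ∃ N', N ≤ N' ∧ ∃ f : Lp ℂ 2 ν, ‖f‖ = 1 ∧ SupportedIn ν f (U n) ∧
      (inner ℂ f (Q N f)).re ≤ 1 / 8 ∧ 7 / 8 ≤ (inner ℂ f (Q N' f)).re := by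
    intro n N
    -- This bound on `‖a f‖` gives `⟨Q N f, f⟩ ≤ N ‖a f‖ ≤ 1/8`; `N + 1` avoids division by zero.
    obtain ⟨W, hW, hWa⟩ := hav (1 / (8 * (N + 1))) (by positivity)
    obtain ⟨C, hC, hC1⟩ := exists_compact_mem_nhds (1 : G)
    let X := interior (U n ∩ W ∩ C)
    have hX : X ∈ 𝓝 (1 : G) :=
      interior_mem_nhds.2 (Filter.inter_mem (Filter.inter_mem (hU n) hW) hC1)
    have hXs : X ⊆ U n ∩ W ∩ C := interior_subset
    obtain ⟨f, hf1, hfX⟩ := exists_unit_supportedIn ν (W := X) isOpen_interior.measurableSet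
      (Measure.measure_pos_of_mem_nhds ν hX).ne'
      ((measure_mono (hXs.trans Set.inter_subset_right)).trans_lt hC.measure_lt_top).ne
    obtain ⟨N₁, hN₁⟩ := hQlim f hf1 (1 / 8) (by norm_num)
    refine ⟨max N N₁, le_max_left _ _, f, hf1,
      hfX.mono fun x hx => (hXs hx).1.1, (hQa N f hf1).trans ?_, ?_⟩
    · have h3 := hWa f hf1 (hfX.mono fun x hx => (hXs hx).1.2)
      rw [le_div_iff₀ (by positivity)] at h3
      nlinarith [norm_nonneg (a f)]
    · exact le_trans (by norm_num) (hN₁ (max N N₁) (le_max_right _ _))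
  choose S hS f hf1 hfU hf2 hf3 using hstep
  -- Each truncation level depends on the previous one: `f n (N n)` is almost invisible to `Q (N n)`
  -- and almost fixed by `Q (N (n + 1))`, with gap `7/8 - 1/8 = 3/4`.
  let N : ℕ → ℕ := fun n => Nat.rec 0 (fun k m => S k m) n
  have hN : ∀ n, N (n + 1) = S n (N n) := fun n => rfl
  have hNmono : Monotone N := monotone_nat_of_le_succ fun n => by rw [hN]; exact hS _ _
  refine ⟨fun n => Q (N (n + 1)) - Q (N n), fun n => f n (N n), fun n => ?_, fun n => ?_,
    fun s => ?_, fun n => hf1 _ _, fun n => hfU _ _, fun n => ?_⟩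
  · exact sub_mem (hQVN _) (hQVN _)
  · exact sub_nonneg.2 (hQmono (hNmono n.le_succ))
  · refine sum_sub_le_of_chain (P := fun n => Q (N n)) (Q := fun n => Q (N (n + 1)))
      (fun n => hQ0 (N n)) (fun m n hmn => ?_) s 1 ((hQ0 0).trans (hQ1 0)) fun n _ => hQ1 (N (n + 1))
    exact hQmono (hNmono (Nat.succ_le_of_lt hmn))
  · exact le_re_inner_sub (hf2 n (N n)) (hf3 n (N n)) (by norm_num)

end Averaging

end

/-! ### Combination of the two bounds -/

theorem mainTheorem2 {G : Type u} [Group G] [TopologicalSpace G] [IsTopologicalGroup G]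
    [LocallyCompactSpace G] [T2Space G] [MeasurableSpace G] [BorelSpace G]
    (ν : Measure G) [ν.IsHaarMeasure] [ν.Regular] (hμ : 1 < nbhdCharacter G) :
    #(TIM ν) = 2 ^ (2 ^ nbhdCharacter G : Cardinal.{u}) := by
  have h := aleph0_le_nbhdCharacter hμ
  -- Indexing by the initial ordinal makes every proper initial segment smaller than `nbhdCharacter
  -- G`, as the transfinite construction requires; in the countable case the system is transported
  -- from `ℕ`.
  refine le_antisymm (mk_TIM_le ν h)
    (le_mk_TIM ν (Γ := (nbhdCharacter G).ord.ToType) h (mk_ord_toType _) fun U hU => ?_)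
  rcases h.lt_or_eq with hlt | heq
  · refine hasAlmostOrthogonalSystem_of_aleph0_lt ν hlt (fun γ => ?_) U hU
    simpa using mk_Iio_lt γ
  · have hΓ : #(nbhdCharacter G).ord.ToType = ℵ₀ := (mk_ord_toType _).trans heq.symm
    obtain ⟨_⟩ := denumerable_iff.2 hΓ
    exact .comp_equiv ν (Denumerable.eqv _)
      (hasAlmostOrthogonalSystem_nat ν heq.symm _ fun n => hU _)
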